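/- For $m\in\mathbb N=\{0,1,2,\dots\}$ let $P_m$ be the complex vector space of homogeneous polynomials of degree $m$ in $x_1,x_2$, with the inner product $\langle x_1^{l}x_2^{m-l},x_1^{k}x_2^{m-k}\rangle=l!\,(m-l)!\,\delta_{lk}$, and let $\rho_m$ be the representation of $SU(2)$ on $P_m$ given by $(\rho_m(g)f)(x_1,x_2)=f((x_1,x_2)g)$. Identify $P_m\otimes P_n$ with the space of polynomials in $x=(x_1,x_2)$, $y=(y_1,y_2)$ that are homogeneous of degree $m$ in $x$ and of degree $n$ in $y$, via $f\otimes g\mapsto f(x)g(y)$. Let $\Delta_{yx}=y_1\frac{\partial}{\partial x_1}+y_2\frac{\partial}{\partial x_2}$, and let $\Gamma_{xy}$ be multiplication by $x_1y_2-y_1x_2$. For $0\le h\le\min\{m,n\}$ define $c_{m,n,h}$ by $c_{m,0,0}=1$ and, for $n\ge1$, $c_{m,n,h}=\frac{1}{(m+1)n}\left(c_{m-1,n-1,h-1}+c_{m+1,n-1,h}\right)$, where the first summand is omitted if $h=0$ and the second is omitted if $h=n$. With $r=m+n-2h$ let $$\alpha_{m,n,h}:P_r\to P_m\otimes P_n,\qquad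 \alpha_{m,n,h}(f)=\sqrt{c_{m,n,h}}\;\Gamma_{xy}^{h}\,\Delta_{yx}^{n-h}f(x),$$ $$\Phi_{m,n,h}:\mathrm{End}(P_r)\to\mathrm{End}(P_m),\qquad \Phi_{m,n,h}(A)=\mathrm{Tr}_{P_n}\!\left(\alpha_{m,n,h}\,A\,\alpha_{m,n,h}^{*}\right),$$ where $\mathrm{Tr}_{P_n}$ is the partial trace over $P_n$. For $r,m\in\mathbb N$ let $EC(r,m)$ be the set of all $\Phi_{m,n,h}$ with $n,h\in\mathbb N$, $0\le h\le\min\{m,n\}$ and $m+n-2h=r$ (the EPOSIC channels from $\mathrm{End}(P_r)$ to $\mathrm{End}(P_m)$). A linear map $\Phi:\mathrm{End}(P_r)\to\mathrm{End}(P_m)$ is called $SU(2)$-equivariant if $\Phi(\rho_r(g)A\rho_r(g)^{-1})=\rho_m(g)\Phi(A)\rho_m(g)^{-1}$ for all $g\in SU(2)$ and $A\in\mathrm{End}(P_r)$. It is a quantum channel if it is completely positive and trace preserving. An $SU(2)$-irreducibly covariant channel is an $SU(2)$-equivariant quantum channel for which the two representations $\rho_r,\rho_m$ are irreducible. Then for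 all $r,m\in\mathbb N$: 1. the set of all $SU(2)$-irreducibly covariant channels $\mathrm{End}(P_r)\to\mathrm{End}(P_m)$ is the convex hull of $EC(r,m)$; 2. the complex linear span of $EC(r,m)$ is the space of all $SU(2)$-equivariant linear maps $\mathrm{End}(P_r)\to\mathrm{End}(P_m)$. -/

import Mathlib

open scoped TensorProduct ComplexOrder CStarAlgebra

noncomputable section

namespace SU2Channel

/-! ### Quantum channels and covariance -/

/-- A linear map `End(H) → End(K)` is completely positive if it is so as a map between the
C⋆-algebras of (automatically bounded) operators on `H` and `K`. -/
def IsCompletelyPositive {H K : Type*}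
    [NormedAddCommGroup H] [InnerProductSpace ℂ H] [FiniteDimensional ℂ H] [CompleteSpace H]
    [NormedAddCommGroup K] [InnerProductSpace ℂ K] [FiniteDimensional ℂ K] [CompleteSpace K]
    (Φ : Module.End ℂ H →ₗ[ℂ] Module.End ℂ K) : Prop :=
  ∃ Ψ : (H →L[ℂ] H) →CP (K →L[ℂ] K), ∀ A : Module.End ℂ H,
    Ψ (LinearMap.toContinuousLinearMap A) = LinearMap.toContinuousLinearMap (Φ A)

/-- A quantum channel: a completely positive, trace preserving linear map. -/
structure IsQuantumChannel {H K : Type*}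
    [NormedAddCommGroup H] [InnerProductSpace ℂ H] [FiniteDimensional ℂ H] [CompleteSpace H]
    [NormedAddCommGroup K] [InnerProductSpace ℂ K] [FiniteDimensional ℂ K] [CompleteSpace K]
    (Φ : Module.End ℂ H →ₗ[ℂ] Module.End ℂ K) : Prop where
  completelyPositive : IsCompletelyPositive Φ
  trace_preserving : ∀ A : Module.End ℂ H, LinearMap.trace ℂ K (Φ A) = LinearMap.trace ℂ H A

/-- `Φ : End(H) → End(K)` is `G`-equivariant for the actions `A ↦ π(g) A π(g⁻¹)`. -/
def IsEquivariant {G H K : Type*} [Group G] [AddCommGroup H] [Module ℂ H]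
    [AddCommGroup K] [Module ℂ K] (π : Representation ℂ G H) (σ : Representation ℂ G K)
    (Φ : Module.End ℂ H →ₗ[ℂ] Module.End ℂ K) : Prop :=
  Representation.IsIntertwiningMap (π.linHom π) (σ.linHom σ) Φ

/-- An irreducibly covariant channel: a quantum channel that is equivariant with respect to two
irreducible representations. -/
structure IsIrreduciblyCovariantChannel {G H K : Type*} [Group G]
    [NormedAddCommGroup H] [InnerProductSpace ℂ H] [FiniteDimensional ℂ H] [CompleteSpace H]
    [NormedAddCommGroup K] [InnerProductSpace ℂ K] [FiniteDimensional ℂ K] [CompleteSpace K]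
    (π : Representation ℂ G H) (σ : Representation ℂ G K)
    (Φ : Module.End ℂ H →ₗ[ℂ] Module.End ℂ K) : Prop where
  irreducible_source : π.IsIrreducible
  irreducible_target : σ.IsIrreducible
  isQuantumChannel : IsQuantumChannel Φ
  isEquivariant : IsEquivariant π σ Φ

/-- The partial trace `End(V ⊗ W) → End(V)`, `A ⊗ B ↦ tr(B) A`. -/
def partialTrace (V W : Type*) [AddCommGroup V] [Module ℂ V] [FiniteDimensional ℂ V]
    [AddCommGroup W] [Module ℂ W] [FiniteDimensional ℂ W] :
    Module.End ℂ (V ⊗[ℂ] W) →ₗ[ℂ] Module.End ℂ V :=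
  (TensorProduct.rid ℂ (Module.End ℂ V)).toLinearMap ∘ₗ
    TensorProduct.map LinearMap.id (LinearMap.trace ℂ W) ∘ₗ
      (homTensorHomEquiv ℂ V W V W).symm.toLinearMap

theorem partialTrace_map (V W : Type*) [AddCommGroup V] [Module ℂ V] [FiniteDimensional ℂ V]
    [AddCommGroup W] [Module ℂ W] [FiniteDimensional ℂ W]
    (A : Module.End ℂ V) (B : Module.End ℂ W) :
    partialTrace V W (TensorProduct.map A B) = LinearMap.trace ℂ W B • A := by
  have h : (homTensorHomEquiv ℂ V W V W).symm (TensorProduct.map A B) = A ⊗ₜ[ℂ] B := by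
    rw [LinearEquiv.symm_apply_eq]
    simp
  simp [partialTrace, h]

/-! ### The irreducible representations of `SU(2)` on binary forms -/

/-- `SU(2)`. -/
abbrev SU2 := Matrix.specialUnitaryGroup (Fin 2) ℂ

/-- `P m`: complex homogeneous polynomials of degree `m` in two variables. -/
def P (m : ℕ) : Type := MvPolynomial.homogeneousSubmodule (Fin 2) ℂ m

instance (m : ℕ) : AddCommGroup (P m) :=
  inferInstanceAs (AddCommGroup (MvPolynomial.homogeneousSubmodule (Fin 2) ℂ m))

instance (m : ℕ) : Module ℂ (P m) :=
  inferInstanceAs (Module ℂ (MvPolynomial.homogeneousSubmodule (Fin 2) ℂ m))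

instance (m : ℕ) : FiniteDimensional ℂ (P m) :=
  Module.Finite.iff_fg.mpr (MvPolynomial.homogeneousSubmodule_fg (Fin 2) ℂ m)

/-- The inclusion of `P m` into the polynomial ring `ℂ[x₁, x₂]`. -/
def incl (m : ℕ) : P m →ₗ[ℂ] MvPolynomial (Fin 2) ℂ :=
  (MvPolynomial.homogeneousSubmodule (Fin 2) ℂ m).subtype

theorem incl_isHomogeneous {m : ℕ} (f : P m) : (incl m f).IsHomogeneous m := f.2

theorem incl_injective (m : ℕ) : Function.Injective (incl m) := Subtype.val_injective

/-- The exponent of the monomial `x₁ˡ x₂ᵐ⁻ˡ`. -/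
def expo (m l : ℕ) : Fin 2 →₀ ℕ := Finsupp.single 0 l + Finsupp.single 1 (m - l)

theorem expo_of_degree {m : ℕ} {d : Fin 2 →₀ ℕ} (hd : d.degree = m) :
    d 0 < m + 1 ∧ expo m (d 0) = d := by
  have h : d 0 + d 1 = m := by
    rw [← hd, Finsupp.degree_eq_sum]
    simp
  refine ⟨by omega, ?_⟩
  ext i
  fin_cases i
  · simp [expo]
  · simp [expo]
    omega

/-- The inner product with `⟨x₁ˡ x₂ᵐ⁻ˡ, x₁ᵏ x₂ᵐ⁻ᵏ⟩ = l! (m - l)! δ_{lk}`, linear in the second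
variable. -/
abbrev formCore (m : ℕ) : InnerProductSpace.Core ℂ (P m) where
  inner f g := ∑ l ∈ Finset.range (m + 1), ((l.factorial * (m - l).factorial : ℕ) : ℂ) *
    (star (MvPolynomial.coeff (expo m l) (incl m f)) * MvPolynomial.coeff (expo m l) (incl m g))
  conj_inner_symm f g := by
    simp only [map_sum, map_mul, starRingEnd_apply, star_star, star_natCast]
    exact Finset.sum_congr rfl fun l _ => by ring
  re_inner_nonneg f := by
    simp only [map_sum]
    refine Finset.sum_nonneg fun l _ => ?_
    rw [Complex.star_def, ← Complex.normSq_eq_conj_mul_self, ← Complex.ofReal_natCast,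
      ← Complex.ofReal_mul]
    exact mul_nonneg (Nat.cast_nonneg _) (Complex.normSq_nonneg _)
  add_left f g k := by
    simp only [map_add, MvPolynomial.coeff_add, star_add, ← Finset.sum_add_distrib]
    exact Finset.sum_congr rfl fun l _ => by ring
  smul_left f g c := by
    simp only [map_smul, MvPolynomial.coeff_smul, smul_eq_mul, star_mul,
      Finset.mul_sum, starRingEnd_apply]
    exact Finset.sum_congr rfl fun l _ => by ring
  definite f hf := by
    have hsum : ∑ l ∈ Finset.range (m + 1), ((l.factorial * (m - l).factorial : ℕ) : ℝ) *
        Complex.normSq (MvPolynomial.coeff (expo m l) (incl m f)) = 0 := by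
      have h : ((∑ l ∈ Finset.range (m + 1), ((l.factorial * (m - l).factorial : ℕ) : ℝ) *
        Complex.normSq (MvPolynomial.coeff (expo m l) (incl m f)) : ℝ) : ℂ) = 0 := by
        rw [← hf]
        push_cast
        exact Finset.sum_congr rfl fun l _ => by
          rw [Complex.normSq_eq_conj_mul_self]
          rfl
      exact_mod_cast h
    rw [Finset.sum_eq_zero_iff_of_nonneg
      fun l _ => mul_nonneg (Nat.cast_nonneg _) (Complex.normSq_nonneg _)] at hsum
    refine incl_injective m (MvPolynomial.ext _ _ fun d => ?_)
    by_cases hd : d.degree = m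
    · obtain ⟨h1, h2⟩ := expo_of_degree hd
      have h3 := hsum (d 0) (Finset.mem_range.mpr h1)
      rw [h2] at h3
      have h4 : (((d 0).factorial * (m - d 0).factorial : ℕ) : ℝ) ≠ 0 := by positivity
      simpa using (mul_eq_zero.mp h3).resolve_left h4
    · simpa using (incl_isHomogeneous f).coeff_eq_zero hd

instance (m : ℕ) : NormedAddCommGroup (P m) := (formCore m).toNormedAddCommGroup

instance (m : ℕ) : InnerProductSpace ℂ (P m) := InnerProductSpace.ofCore (formCore m).toCore

instance (m : ℕ) : CompleteSpace (P m) := FiniteDimensional.complete ℂ (P m)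

/-- The linear substitution `f(x₁, x₂) ↦ f((x₁, x₂) g)`. -/
def subst (g : Matrix (Fin 2) (Fin 2) ℂ) : MvPolynomial (Fin 2) ℂ →ₐ[ℂ] MvPolynomial (Fin 2) ℂ :=
  MvPolynomial.aeval fun j => ∑ i, MvPolynomial.C (g i j) * MvPolynomial.X i

theorem subst_isHomogeneous (g : Matrix (Fin 2) (Fin 2) ℂ) {m : ℕ} {f : MvPolynomial (Fin 2) ℂ}
    (hf : f.IsHomogeneous m) : (subst g f).IsHomogeneous m := by
  have h := hf.aeval (fun j => ∑ i, MvPolynomial.C (g i j) * MvPolynomial.X i) (n := 1)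
    fun j => MvPolynomial.IsHomogeneous.sum _ _ _ fun i _ => MvPolynomial.isHomogeneous_C_mul_X _ i
  simpa [subst] using h

theorem subst_one : subst 1 = AlgHom.id ℂ _ := by
  ext1 j
  fin_cases j <;> simp [subst]

theorem subst_mul (g h : Matrix (Fin 2) (Fin 2) ℂ) : subst (g * h) = (subst g).comp (subst h) := by
  ext1 j
  simp [subst, Matrix.mul_apply, Fin.sum_univ_two]
  ring

/-- The representation `ρ_m` of `SU(2)` on `P m`: `(ρ_m(g) f)(x₁, x₂) = f((x₁, x₂) g)`. -/
def rho (m : ℕ) : Representation ℂ SU2 (P m) where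
  toFun g := ((subst g.1).toLinearMap ∘ₗ incl m).codRestrict
    (MvPolynomial.homogeneousSubmodule (Fin 2) ℂ m)
    fun f => subst_isHomogeneous g.1 (incl_isHomogeneous f)
  map_one' := by
    ext1 f
    exact incl_injective m (congrArg (fun φ => φ (incl m f)) subst_one)
  map_mul' g h := by
    ext1 f
    exact incl_injective m (congrArg (fun φ => φ (incl m f)) (subst_mul g.1 h.1))

theorem incl_rho (m : ℕ) (g : SU2) (f : P m) : incl m (rho m g f) = subst g.1 (incl m f) := rfl

/-! ### The isometries `α_{m,n,h}` and the EPOSIC channels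

Polynomials in `x = (x₁, x₂)` and `y = (y₁, y₂)` are elements of `MvPolynomial (Fin 2 ⊕ Fin 2) ℂ`,
the `x`-variables being indexed by `Sum.inl` and the `y`-variables by `Sum.inr`. -/

/-- The coefficients `c_{m,n,h}`, meaningful for `h ≤ min m n`. They satisfy `c_{m,0,0} = 1` and,
for `n ≥ 1`, `(m + 1) n c_{m,n,h} = c_{m-1,n-1,h-1} + c_{m+1,n-1,h}`, where the first summand is
dropped for `h = 0` and the second one for `h = n`. -/
def cgCoeff : ℕ → ℕ → ℕ → ℝ
  | _, 0, _ => 1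
  | m, n + 1, h => (1 / ((m + 1) * (n + 1))) *
      ((if 0 < h then cgCoeff (m - 1) n (h - 1) else 0) +
        (if h < n + 1 then cgCoeff (m + 1) n h else 0))

/-- `Δ_{yx} = y₁ ∂/∂x₁ + y₂ ∂/∂x₂`. -/
def Δyx : Module.End ℂ (MvPolynomial (Fin 2 ⊕ Fin 2) ℂ) :=
  ∑ i : Fin 2, LinearMap.mulLeft ℂ (MvPolynomial.X (Sum.inr i)) ∘ₗ
    (MvPolynomial.pderiv (Sum.inl i)).toLinearMap

/-- `Γ_{xy}`: multiplication by `x₁ y₂ - y₁ x₂`. -/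
def Γxy : Module.End ℂ (MvPolynomial (Fin 2 ⊕ Fin 2) ℂ) :=
  LinearMap.mulLeft ℂ (MvPolynomial.X (Sum.inl 0) * MvPolynomial.X (Sum.inr 1) -
    MvPolynomial.X (Sum.inr 0) * MvPolynomial.X (Sum.inl 1))

/-- The projection of a polynomial onto its homogeneous component of degree `m`. -/
def homComp (m : ℕ) : MvPolynomial (Fin 2) ℂ →ₗ[ℂ] P m :=
  (MvPolynomial.homogeneousComponent m).codRestrict
    (MvPolynomial.homogeneousSubmodule (Fin 2) ℂ m) (MvPolynomial.homogeneousComponent_mem m)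

/-- The identification of polynomials in `x, y` of bidegree `(m, n)` with `P m ⊗ P n`, the inverse
of `f ⊗ g ↦ f(x) g(y)`. (On all of `ℂ[x, y]`: first take the component of bidegree `(m, n)`.) -/
def toTensor (m n : ℕ) : MvPolynomial (Fin 2 ⊕ Fin 2) ℂ →ₗ[ℂ] P m ⊗[ℂ] P n :=
  TensorProduct.map (homComp m) (homComp n) ∘ₗ
    (MvPolynomial.tensorEquivSum ℂ (Fin 2) (Fin 2) ℂ).symm.toLinearMap

theorem toTensor_mul (m n : ℕ) (f : P m) (g : P n) :
    toTensor m n (MvPolynomial.rename Sum.inl (incl m f) * MvPolynomial.rename Sum.inr (incl n g)) =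
      f ⊗ₜ[ℂ] g := by
  have h : ∀ a b : MvPolynomial (Fin 2) ℂ, (MvPolynomial.tensorEquivSum ℂ (Fin 2) (Fin 2) ℂ).symm
      (MvPolynomial.rename Sum.inl a * MvPolynomial.rename Sum.inr b) = a ⊗ₜ[ℂ] b := by
    intro a b
    rw [AlgEquiv.symm_apply_eq]
    have h1 : MvPolynomial.rename (R := ℂ) (Sum.inl : Fin 2 → Fin 2 ⊕ Fin 2) =
        (MvPolynomial.tensorEquivSum ℂ (Fin 2) (Fin 2) ℂ).toAlgHom.comp
          Algebra.TensorProduct.includeLeft := by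
      ext1 i
      simp
    have h2 : MvPolynomial.rename (R := ℂ) (Sum.inr : Fin 2 → Fin 2 ⊕ Fin 2) =
        (MvPolynomial.tensorEquivSum ℂ (Fin 2) (Fin 2) ℂ).toAlgHom.comp
          Algebra.TensorProduct.includeRight := by
      ext1 i
      simp
    rw [h1, h2]
    simp [← map_mul]
  have hc : ∀ (k : ℕ) (p : P k), homComp k (incl k p) = p := fun k p =>
    incl_injective k (MvPolynomial.homogeneousComponent_eq_self (incl_isHomogeneous p))
  simp [toTensor, h, hc]

/-- The map `α_{m,n,h} : P r → P m ⊗ P n`, where `r = m + n - 2h` and `h ≤ min m n`: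
`f(x) ↦ √c_{m,n,h} Γ_{xy}^h Δ_{yx}^{n-h} f(x)`. -/
def alpha (r m n h : ℕ) : P r →ₗ[ℂ] P m ⊗[ℂ] P n :=
  (Real.sqrt (cgCoeff m n h) : ℂ) •
    (toTensor m n ∘ₗ (Γxy ^ h) ∘ₗ (Δyx ^ (n - h)) ∘ₗ
      (MvPolynomial.rename Sum.inl).toLinearMap ∘ₗ incl r)

/-- The map `Φ_{m,n,h} : End(P r) → End(P m)`, `A ↦ Tr_{P n}(α A α*)`, where `r = m + n - 2h`
and `h ≤ min m n`. -/
def eposic (r m n h : ℕ) : Module.End ℂ (P r) →ₗ[ℂ] Module.End ℂ (P m) where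
  toFun A := partialTrace (P m) (P n) (alpha r m n h ∘ₗ A ∘ₗ (alpha r m n h).adjoint)
  map_add' A B := by simp [LinearMap.add_comp, LinearMap.comp_add]
  map_smul' c A := by simp [LinearMap.smul_comp, LinearMap.comp_smul]

/-- `EC(r, m)`: the set of EPOSIC channels from `End(P r)` to `End(P m)`, that is, of all
`Φ_{m,n,h}` with `r = m + n - 2h` and `0 ≤ h ≤ min m n`. -/
def EC (r m : ℕ) : Set (Module.End ℂ (P r) →ₗ[ℂ] Module.End ℂ (P m)) :=
  {Φ | ∃ n h : ℕ, r + 2 * h = m + n ∧ h ≤ min m n ∧ Φ = eposic r m n h}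

end SU2Channel

end

/-!
An equivariant map `Φ : End(H) → End(K)` has a Choi operator: an endomorphism of `Hom(H, K)` that
commutes with the group and is positive whenever `Φ` is completely positive. Equivariant isometries
`α_i : H → K ⊗ N_i` with pairwise inequivalent irreducible `N_i` embed the duals of the `N_i` into
`Hom(H, K)`, and when the dimensions add up these copies exhaust `Hom(H, K)`, which is therefore
multiplicity free. By Schur's lemma the Choi operator is then a combination of the projections onto
these copies, which are, up to scalars, the Choi operators of `A ↦ Tr_{N_i}(α_i A α_i*)`.
Positivity forces nonnegative weights, and trace preservation makes them sum to one.

For `SU(2)` the `N_i` are the spaces of binary forms in the Clebsch-Gordan decomposition. That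
`α_{m,n,h}` is an isometry reduces, again by Schur's lemma, to the norm of the image of a highest
weight vector, where the recursion for `c_{m,n,h}` meets a Vandermonde-type identity.
-/

noncomputable section

namespace SU2Channel

section LinearMapGenerators

variable {R U V W : Type*} [CommRing R] [AddCommGroup U] [Module R U] [AddCommGroup V] [Module R V]
  [AddCommGroup W] [Module R W]

theorem sum_coord_smulRight {ι : Type*} [Fintype ι] (b : Module.Basis ι R V) (A : V →ₗ[R] W) :
    ∑ i, (b.coord i).smulRight (A (b i)) = A := by
  ext v
  simp only [LinearMap.sum_apply, LinearMap.smulRight_apply, Module.Basis.coord_apply, ← map_smul,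
    ← map_sum, b.sum_repr]

theorem linearMap_ext_smulRight [Module.Free R V] [Module.Finite R V]
    {F G : (V →ₗ[R] W) →ₗ[R] U}
    (h : ∀ (φ : Module.Dual R V) (w : W), F (φ.smulRight w) = G (φ.smulRight w)) : F = G := by
  ext1 A
  rw [← sum_coord_smulRight (Module.Free.chooseBasis R V) A, map_sum, map_sum]
  exact Finset.sum_congr rfl fun i _ => h _ _

theorem linearMap_ext_tensorMap [Module.Free R V] [Module.Finite R V] [Module.Free R W]
    [Module.Finite R W] {F G : Module.End R (V ⊗[R] W) →ₗ[R] U}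
    (h : ∀ (A : Module.End R V) (B : Module.End R W),
      F (TensorProduct.map A B) = G (TensorProduct.map A B)) : F = G := by
  rw [← LinearMap.cancel_right (homTensorHomEquiv R V W V W).surjective]
  exact TensorProduct.ext' fun A B => by simpa using h A B

end LinearMapGenerators

section Contraction

variable {R V W : Type*} [CommRing R] [AddCommGroup V] [Module R V] [AddCommGroup W] [Module R W]

/-- Contraction of the second tensor factor with a functional: `v ⊗ w ↦ ψ(w) v`. -/
def contract (V : Type*) [AddCommGroup V] [Module R V] (ψ : Module.Dual R W) :
    V ⊗[R] W →ₗ[R] V :=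
  (TensorProduct.rid R V).toLinearMap ∘ₗ ψ.lTensor V

@[simp]
theorem contract_tmul (ψ : Module.Dual R W) (v : V) (w : W) :
    contract V ψ (v ⊗ₜ w) = ψ w • v := by
  simp [contract]

theorem sum_mk_flip_comp_contract {ι : Type*} [Fintype ι] (b : Module.Basis ι R W) :
    ∑ i, (TensorProduct.mk R V W).flip (b i) ∘ₗ contract V (b.coord i) = LinearMap.id :=
  TensorProduct.ext' fun v w => by
    simp only [LinearMap.sum_apply, LinearMap.comp_apply, contract_tmul, map_smul,
      LinearMap.flip_apply, TensorProduct.mk_apply, Module.Basis.coord_apply, LinearMap.id_apply,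
      ← TensorProduct.tmul_smul, ← TensorProduct.tmul_sum, b.sum_repr]

end Contraction

section PartialTrace

variable {V W : Type*} [AddCommGroup V] [Module ℂ V] [FiniteDimensional ℂ V]
  [AddCommGroup W] [Module ℂ W] [FiniteDimensional ℂ W]

theorem trace_comp_partialTrace :
    LinearMap.trace ℂ V ∘ₗ partialTrace V W = LinearMap.trace ℂ (V ⊗[ℂ] W) :=
  linearMap_ext_tensorMap fun A B => by
    rw [LinearMap.comp_apply, partialTrace_map, LinearMap.trace_tensorProduct', map_smul,
      smul_eq_mul, mul_comm]

theorem partialTrace_eq_sum {ι : Type*} [Fintype ι] (b : Module.Basis ι ℂ W)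
    (X : Module.End ℂ (V ⊗[ℂ] W)) :
    partialTrace V W X =
      ∑ i, contract V (b.coord i) ∘ₗ X ∘ₗ (TensorProduct.mk ℂ V W).flip (b i) := by
  classical
  let S : Module.End ℂ (V ⊗[ℂ] W) →ₗ[ℂ] Module.End ℂ V :=
    ∑ i, LinearMap.llcomp ℂ V (V ⊗[ℂ] W) V (contract V (b.coord i)) ∘ₗ
      LinearMap.lcomp ℂ (V ⊗[ℂ] W) ((TensorProduct.mk ℂ V W).flip (b i))
  have h : partialTrace V W = S := linearMap_ext_tensorMap fun A B => by
    ext v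
    simp [S, partialTrace_map, LinearMap.trace_eq_matrix_trace ℂ b, LinearMap.sum_apply,
      Matrix.trace, LinearMap.toMatrix_apply, Finset.sum_smul]
  rw [h, LinearMap.sum_apply]
  rfl

end PartialTrace

section CompletePositivity

theorem cstarMatrix_sum_apply {k A ι : Type*} [AddCommMonoid A] (s : Finset ι)
    (f : ι → CStarMatrix k k A) (p q : k) : (∑ i ∈ s, f i) p q = ∑ i ∈ s, f i p q :=
  map_sum ({ toFun := fun M => M p q, map_zero' := rfl, map_add' := fun _ _ => rfl } :
    CStarMatrix k k A →+ A) f s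

variable {H K : Type*} [NormedAddCommGroup H] [InnerProductSpace ℂ H] [CompleteSpace H]
  [NormedAddCommGroup K] [InnerProductSpace ℂ K] [CompleteSpace K]

theorem sum_inner_nonneg_of_cstarMatrix_nonneg {k : Type*} [Fintype k]
    {M : CStarMatrix k k (K →L[ℂ] K)} (hM : 0 ≤ M) (x : k → K) :
    0 ≤ ∑ i, ∑ j, inner ℂ (x i) (M i j (x j)) := by
  rw [StarOrderedRing.nonneg_iff] at hM
  induction hM using AddSubmonoid.closure_induction with
  | zero => simp
  | add M N _ _ hM hN =>
    refine (add_nonneg hM hN).trans_eq ?_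
    simp only [CStarMatrix.add_apply, add_apply, inner_add_right, Finset.sum_add_distrib]
  | mem M hM =>
    obtain ⟨N, rfl⟩ := hM
    have h : ∑ i, ∑ j, inner ℂ (x i) ((star N * N) i j (x j)) =
        ∑ l, inner ℂ (∑ i, N l i (x i)) (∑ j, N l j (x j)) := by
      simp only [CStarMatrix.mul_apply, CStarMatrix.star_apply, sum_apply,
        inner_sum, sum_inner, mul_apply_eq_comp,
        ContinuousLinearMap.star_eq_adjoint, ContinuousLinearMap.adjoint_inner_right]
      rw [Finset.sum_congr rfl fun i _ => Finset.sum_comm, Finset.sum_comm]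
      exact Finset.sum_congr rfl fun l _ => Finset.sum_comm
    refine h ▸ Finset.sum_nonneg fun l _ => ?_
    rw [inner_self_eq_norm_sq_to_K]
    positivity

theorem cstarMatrix_star_mul_nonneg {k A : Type*} [Fintype k] [NonUnitalCStarAlgebra A]
    [PartialOrder A] [StarOrderedRing A] (N : k → A) :
    0 ≤ (CStarMatrix.ofMatrix fun i j => star (N i) * N j : CStarMatrix k k A) := by
  classical
  rcases isEmpty_or_nonempty k with hk | ⟨⟨k₀⟩⟩
  · exact le_of_eq (CStarMatrix.ext fun i => hk.elim i)
  let R : CStarMatrix k k A := CStarMatrix.ofMatrix fun l j => if l = k₀ then N j else 0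
  have hR : ∀ l j, R l j = if l = k₀ then N j else 0 := fun _ _ => rfl
  convert star_mul_self_nonneg R using 1
  refine CStarMatrix.ext fun i j => ?_
  change star (N i) * N j = _
  simp [CStarMatrix.mul_apply, CStarMatrix.star_apply, hR]

theorem cstarMatrix_rankOne_nonneg {k : Type*} [Fintype k] (e : k → H) :
    0 ≤ (CStarMatrix.ofMatrix fun i j => InnerProductSpace.rankOne ℂ (e i) (e j) :
      CStarMatrix k k (H →L[ℂ] H)) := by
  rcases subsingleton_or_nontrivial H with hH | hH
  · exact le_of_eq (CStarMatrix.ext fun i j => Subsingleton.elim _ _)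
  obtain ⟨u, hu⟩ := exists_norm_eq H zero_le_one
  convert cstarMatrix_star_mul_nonneg fun i => InnerProductSpace.rankOne ℂ u (e i) using 5 with i j
  simp [ContinuousLinearMap.star_eq_adjoint, ContinuousLinearMap.mul_def,
    InnerProductSpace.rankOne_comp_rankOne, hu]

theorem cstarMatrix_gram_nonneg {k : Type*} [Fintype k] [FiniteDimensional ℂ H]
    (T : k → K →L[ℂ] H) :
    0 ≤ (CStarMatrix.ofMatrix fun p q => (T p).adjoint ∘L T q : CStarMatrix k k (K →L[ℂ] K)) := by
  let b := stdOrthonormalBasis ℂ H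
  have h : ∀ p q, (T p).adjoint ∘L T q = ∑ a,
      InnerProductSpace.rankOne ℂ ((T p).adjoint (b a)) ((T q).adjoint (b a)) := fun p q => by
    conv_lhs => rw [← (T q).id_comp, ← b.sum_rankOne_eq_id]
    simp only [ContinuousLinearMap.finsetSum_comp, ContinuousLinearMap.comp_finsetSum,
      InnerProductSpace.rankOne_comp, InnerProductSpace.comp_rankOne]
  refine (Finset.sum_nonneg (s := Finset.univ) fun a _ =>
    cstarMatrix_rankOne_nonneg fun p => (T p).adjoint (b a)).trans_eq ?_
  refine CStarMatrix.ext fun p q => ?_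
  rw [cstarMatrix_sum_apply]
  exact (h p q).symm

variable [FiniteDimensional ℂ H] [FiniteDimensional ℂ K]
  {Φ Ψ : Module.End ℂ H →ₗ[ℂ] Module.End ℂ K}

theorem IsCompletelyPositive.sum_inner_nonneg (hΦ : IsCompletelyPositive Φ) {k : Type*} [Fintype k]
    (e : k → H) (x : k → K) :
    0 ≤ ∑ i, ∑ j, inner ℂ (x i)
      (Φ (InnerProductSpace.rankOne ℂ (e i) (e j)).toLinearMap (x j)) := by
  obtain ⟨Ψ, hΨ⟩ := hΦ
  have h := sum_inner_nonneg_of_cstarMatrix_nonneg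
    (CompletelyPositiveMap.map_cstarMatrix_nonneg Ψ _ (cstarMatrix_rankOne_nonneg e)) x
  convert h using 6 with i _ j _
  exact (congrArg (fun T : K →L[ℂ] K => T (x j))
    (hΨ (InnerProductSpace.rankOne ℂ (e i) (e j)).toLinearMap)).symm

theorem IsCompletelyPositive.add (hΦ : IsCompletelyPositive Φ) (hΨ : IsCompletelyPositive Ψ) :
    IsCompletelyPositive (Φ + Ψ) := by
  obtain ⟨Φ', hΦ'⟩ := hΦ
  obtain ⟨Ψ', hΨ'⟩ := hΨ
  exact ⟨{ toLinearMap := Φ'.toLinearMap + Ψ'.toLinearMap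
           map_cstarMatrix_nonneg' := fun k M hM =>
            add_nonneg (Φ'.map_cstarMatrix_nonneg' k M hM) (Ψ'.map_cstarMatrix_nonneg' k M hM) },
    fun A => congrArg₂ (· + ·) (hΦ' A) (hΨ' A)⟩

theorem IsCompletelyPositive.smul (hΦ : IsCompletelyPositive Φ) {c : ℝ} (hc : 0 ≤ c) :
    IsCompletelyPositive (c • Φ) := by
  obtain ⟨Φ', hΦ'⟩ := hΦ
  exact ⟨{ toLinearMap := c • Φ'.toLinearMap
           map_cstarMatrix_nonneg' := fun k M hM =>
            smul_nonneg hc (Φ'.map_cstarMatrix_nonneg' k M hM) },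
    fun A => congrArg (c • ·) (hΦ' A)⟩

theorem isCompletelyPositive_of_nonneg
    (h : ∀ (k : ℕ) (N : CStarMatrix (Fin k) (Fin k) (H →L[ℂ] H)),
      0 ≤ (CStarMatrix.ofMatrix fun i j =>
        LinearMap.toContinuousLinearMap (Φ ((star N * N) i j).toLinearMap) :
          CStarMatrix (Fin k) (Fin k) (K →L[ℂ] K))) :
    IsCompletelyPositive Φ := by
  refine ⟨{ toLinearMap := LinearMap.toContinuousLinearMap.toLinearMap ∘ₗ Φ ∘ₗ
              LinearMap.toContinuousLinearMap.symm.toLinearMap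
            map_cstarMatrix_nonneg' := fun k M hM => ?_ }, fun A => rfl⟩
  rw [StarOrderedRing.nonneg_iff] at hM
  induction hM using AddSubmonoid.closure_induction with
  | zero => exact le_of_eq (CStarMatrix.ext fun i j => by simp)
  | add M N _ _ hM hN => exact (add_nonneg hM hN).trans_eq (CStarMatrix.ext fun i j => by simp)
  | mem M hM =>
    obtain ⟨N, rfl⟩ := hM
    exact h k N

theorem isCompletelyPositive_of_kraus {ι : Type*} [Fintype ι] (R : ι → H →ₗ[ℂ] K)
    (hR : ∀ A, Φ A = ∑ i, R i ∘ₗ A ∘ₗ (R i).adjoint) : IsCompletelyPositive Φ := by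
  refine isCompletelyPositive_of_nonneg fun k N => ?_
  let R' : ι → H →L[ℂ] K := fun i => LinearMap.toContinuousLinearMap (R i)
  have h : ∀ p q, LinearMap.toContinuousLinearMap (Φ ((star N * N) p q).toLinearMap) =
      ∑ i, ∑ l, (N l p ∘L (R' i).adjoint).adjoint ∘L (N l q ∘L (R' i).adjoint) := by
    intro p q
    ext v
    simp only [LinearMap.coe_toContinuousLinearMap', hR, LinearMap.sum_apply, sum_apply]
    refine Finset.sum_congr rfl fun i _ => ?_
    simp [CStarMatrix.mul_apply, CStarMatrix.star_apply, ContinuousLinearMap.star_eq_adjoint,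
      ContinuousLinearMap.adjoint_comp, R']
    rfl
  refine (Finset.sum_nonneg (s := Finset.univ) fun i _ => Finset.sum_nonneg (s := Finset.univ)
    fun l _ => cstarMatrix_gram_nonneg fun p => N l p ∘L (R' i).adjoint).trans_eq
    (CStarMatrix.ext fun p q => ?_)
  simp only [cstarMatrix_sum_apply]
  exact (h p q).symm

end CompletePositivity

section Choi

variable {R H K : Type*} [CommRing R] [AddCommGroup H] [Module R H] [Module.Free R H]
  [Module.Finite R H] [AddCommGroup K] [Module R K]

/-- The reshuffling of a map `End(H) → End(K)` into an operator on `Hom(H, K)`, its Choi operator: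
it exchanges the two vector arguments of the map evaluated at a rank one operator. -/
def choi : (Module.End R H →ₗ[R] Module.End R K) →ₗ[R] Module.End R (H →ₗ[R] K) where
  toFun Φ := TensorProduct.lift (LinearMap.lflip.toLinearMap ∘ₗ LinearMap.smulRightₗ.compr₂ Φ) ∘ₗ
    (dualTensorHomEquiv R H K).symm.toLinearMap
  map_add' Φ Ψ := by
    rw [← LinearMap.cancel_right (dualTensorHomEquiv R H K).surjective]
    exact TensorProduct.ext' fun φ z => by ext; simp
  map_smul' c Φ := by
    rw [← LinearMap.cancel_right (dualTensorHomEquiv R H K).surjective]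
    exact TensorProduct.ext' fun φ z => by ext; simp

theorem choi_smulRight (Φ : Module.End R H →ₗ[R] Module.End R K) (φ : Module.Dual R H) (z : K)
    (v : H) : choi Φ (φ.smulRight z) v = Φ (φ.smulRight v) z := by
  have h : (dualTensorHomEquiv R H K).symm (φ.smulRight z) = φ ⊗ₜ z := by
    rw [LinearEquiv.symm_apply_eq]
    ext w
    simp
  exact congrArg
    (TensorProduct.lift (LinearMap.lflip.toLinearMap ∘ₗ LinearMap.smulRightₗ.compr₂ Φ) · v) h

theorem choi_apply (Φ : Module.End R H →ₗ[R] Module.End R K) (X : H →ₗ[R] K) {ι : Type*}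
    [Fintype ι] (b : Module.Basis ι R H) (v : H) :
    choi Φ X v = ∑ i, Φ ((b.coord i).smulRight v) (X (b i)) := by
  conv_lhs => rw [← sum_coord_smulRight b X]
  simp only [map_sum, LinearMap.sum_apply, choi_smulRight]

theorem choi_injective : Function.Injective (choi (R := R) (H := H) (K := K)) := by
  intro Φ Ψ h
  refine linearMap_ext_smulRight fun φ v => LinearMap.ext fun z => ?_
  rw [← choi_smulRight, ← choi_smulRight, h]

end Choi

theorem linHom_smulRight {R G H K : Type*} [CommRing R] [Group G] [AddCommGroup H] [Module R H]
    [AddCommGroup K] [Module R K] (π : Representation R G H) (σ : Representation R G K) (g : G)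
    (φ : Module.Dual R H) (z : K) :
    π.linHom σ g (φ.smulRight z) = (φ ∘ₗ π g⁻¹).smulRight (σ g z) := by
  ext v
  simp [Representation.linHom_apply]

theorem isIntertwiningMap_choi {G H K : Type*} [Group G] [AddCommGroup H] [Module ℂ H]
    [FiniteDimensional ℂ H] [AddCommGroup K] [Module ℂ K] {π : Representation ℂ G H}
    {σ : Representation ℂ G K} {Φ : Module.End ℂ H →ₗ[ℂ] Module.End ℂ K}
    (hΦ : IsEquivariant π σ Φ) :
    Representation.IsIntertwiningMap (π.linHom σ) (π.linHom σ) (choi Φ) := by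
  refine ⟨fun g X => congrArg (· X) (linearMap_ext_smulRight
    (F := choi Φ ∘ₗ π.linHom σ g) (G := π.linHom σ g ∘ₗ choi Φ) fun φ z => ?_)⟩
  ext v
  have h : (φ ∘ₗ π g⁻¹).smulRight v = π.linHom π g (φ.smulRight (π g⁻¹ v)) := by
    rw [linHom_smulRight, Representation.self_inv_apply]
  calc choi Φ (π.linHom σ g (φ.smulRight z)) v
      = Φ (π.linHom π g (φ.smulRight (π g⁻¹ v))) (σ g z) := by
        rw [linHom_smulRight, choi_smulRight, h]
    _ = σ g (Φ (φ.smulRight (π g⁻¹ v)) z) := by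
        rw [hΦ.isIntertwining]
        simp [Representation.linHom_apply]
    _ = π.linHom σ g (choi Φ (φ.smulRight z)) v := by
        rw [← choi_smulRight]
        rfl

section ChoiPositivity

theorem coord_toBasis_eq_innerSL {H ι : Type*} [NormedAddCommGroup H]
    [InnerProductSpace ℂ H] [Fintype ι] (b : OrthonormalBasis ι ℂ H) (i : ι) :
    b.toBasis.coord i = (innerSL ℂ (b i)).toLinearMap := by
  ext v
  simp [OrthonormalBasis.repr_apply_apply]

variable {H K : Type*} [NormedAddCommGroup H] [InnerProductSpace ℂ H] [FiniteDimensional ℂ H]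
  [NormedAddCommGroup K] [InnerProductSpace ℂ K] [FiniteDimensional ℂ K]

theorem IsCompletelyPositive.trace_adjoint_comp_choi_nonneg [CompleteSpace H] [CompleteSpace K]
    {Φ : Module.End ℂ H →ₗ[ℂ] Module.End ℂ K} (hΦ : IsCompletelyPositive Φ) (X : H →ₗ[ℂ] K) :
    0 ≤ LinearMap.trace ℂ H (X.adjoint ∘ₗ choi Φ X) := by
  let b := stdOrthonormalBasis ℂ H
  refine (hΦ.sum_inner_nonneg b fun i => X (b i)).trans_eq ?_
  rw [LinearMap.trace_eq_sum_inner _ b]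
  refine Finset.sum_congr rfl fun i _ => ?_
  rw [LinearMap.comp_apply, LinearMap.adjoint_inner_right, choi_apply Φ X b.toBasis, inner_sum]
  refine Finset.sum_congr rfl fun j _ => ?_
  rw [coord_toBasis_eq_innerSL, OrthonormalBasis.coe_toBasis]
  rfl

theorem choi_apply_of_kraus {Φ : Module.End ℂ H →ₗ[ℂ] Module.End ℂ K} {ι : Type*} [Fintype ι]
    {R : ι → H →ₗ[ℂ] K} (hR : ∀ A, Φ A = ∑ i, R i ∘ₗ A ∘ₗ (R i).adjoint) (X : H →ₗ[ℂ] K) :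
    choi Φ X = ∑ i, LinearMap.trace ℂ H ((R i).adjoint ∘ₗ X) • R i := by
  let T : (H →ₗ[ℂ] K) →ₗ[ℂ] (H →ₗ[ℂ] K) :=
    ∑ i, (LinearMap.trace ℂ H ∘ₗ LinearMap.llcomp ℂ H K H (R i).adjoint).smulRight (R i)
  have h : choi Φ = T := linearMap_ext_smulRight fun φ z => by
    ext v
    simp only [choi_smulRight, hR, T, LinearMap.sum_apply, LinearMap.smulRight_apply,
      LinearMap.comp_apply, LinearMap.smul_apply, map_smul]
    refine Finset.sum_congr rfl fun i _ => ?_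
    have hi : LinearMap.llcomp ℂ H K H (R i).adjoint (φ.smulRight z) =
        φ.smulRight ((R i).adjoint z) := by
      ext x
      simp
    rw [hi, LinearMap.trace_smulRight]
  rw [h, LinearMap.sum_apply]
  rfl

end ChoiPositivity

section Schur

variable {k G V W : Type*} [Field k] [Group G] [AddCommGroup V] [Module k V]
  [AddCommGroup W] [Module k W] {π : Representation k G V} {σ : Representation k G W}

theorem isIrreducible_iff_invariant :
    π.IsIrreducible ↔ Nontrivial V ∧
      ∀ S : Submodule k V, (∀ g, ∀ v ∈ S, π g v ∈ S) → S = ⊥ ∨ S = ⊤ := by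
  refine ⟨fun hπ => ⟨?_, fun S hS => (hπ.eq_bot_or_eq_top ⟨S, fun g _ hv => hS g _ hv⟩).imp
    (congrArg Subrepresentation.toSubmodule) (congrArg Subrepresentation.toSubmodule)⟩,
    fun ⟨_, hπ⟩ => { exists_pair_ne := ⟨⊥, ⊤, fun h => ?_⟩, eq_bot_or_eq_top := fun S => ?_ }⟩
  · obtain ⟨S, T, hST⟩ := hπ.exists_pair_ne
    by_contra hV
    have := not_nontrivial_iff_subsingleton.mp hV
    exact hST (Subrepresentation.toSubmodule_injective (Subsingleton.elim _ _))
  · exact bot_ne_top (α := Submodule k V) (congrArg Subrepresentation.toSubmodule h)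
  · exact (hπ S.toSubmodule fun g _ hv => S.apply_mem_toSubmodule g hv).imp
      (fun h => Subrepresentation.toSubmodule_injective h)
      (fun h => Subrepresentation.toSubmodule_injective h)

theorem isIrreducible_dual [FiniteDimensional k V] (hπ : π.IsIrreducible) :
    π.dual.IsIrreducible := by
  obtain ⟨_, hinv⟩ := isIrreducible_iff_invariant.mp hπ
  refine isIrreducible_iff_invariant.mpr ⟨inferInstance, fun S hS => ?_⟩
  have hS' : ∀ g, ∀ v ∈ S.dualCoannihilator, π g v ∈ S.dualCoannihilator := fun g v hv => by
    rw [Submodule.mem_dualCoannihilator] at hv ⊢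
    intro ψ hψ
    simpa [Representation.dual_apply, Module.Dual.transpose_apply] using hv _ (hS g⁻¹ ψ hψ)
  rw [← Subspace.dualCoannihilator_dualAnnihilator_eq (W := S)]
  rcases hinv _ hS' with h | h
  · exact Or.inr (by rw [h, Submodule.dualAnnihilator_bot])
  · exact Or.inl (by rw [h, Submodule.dualAnnihilator_top])

theorem isEmpty_equiv_dual [FiniteDimensional k V] [FiniteDimensional k W]
    (h : IsEmpty (σ.Equiv π)) : IsEmpty (π.dual.Equiv σ.dual) := by
  refine ⟨fun e => h.false ?_⟩
  let φ : W ≃ₗ[k] V := (Module.evalEquiv k W).trans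
    (e.toLinearEquiv.dualMap.trans (Module.evalEquiv k V).symm)
  have hφ : ∀ (f : Module.Dual k V) (w : W), f (φ w) = e f w := fun f w =>
    Module.apply_evalEquiv_symm_apply k V f _
  refine Representation.Equiv.mk φ fun g => LinearMap.ext fun w => ?_
  refine (Module.evalEquiv k V).injective (LinearMap.ext fun f => ?_)
  calc f (φ (σ g w)) = σ.dual g⁻¹ (e f) w := by
        simp [hφ, Representation.dual_apply, Module.Dual.transpose_apply]
    _ = (π.dual g⁻¹ f) (φ w) := by
        rw [hφ]
        exact congrArg (fun ψ => ψ w) (e.toIntertwiningMap.isIntertwining _ _ g⁻¹ f).symm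
    _ = f (π g (φ w)) := by simp [Representation.dual_apply, Module.Dual.transpose_apply]

theorem isIntertwiningMap_comp {U : Type*} [AddCommGroup U] [Module k U]
    {τ : Representation k G U} {f : W →ₗ[k] U} {g : V →ₗ[k] W}
    (hf : Representation.IsIntertwiningMap σ τ f) (hg : Representation.IsIntertwiningMap π σ g) :
    Representation.IsIntertwiningMap π τ (f ∘ₗ g) :=
  ⟨fun x v => by simp [hf.isIntertwining, hg.isIntertwining]⟩

theorem intertwining_eq_zero [π.IsIrreducible] [σ.IsIrreducible] [IsEmpty (π.Equiv σ)]
    {f : V →ₗ[k] W} (hf : Representation.IsIntertwiningMap π σ f) : f = 0 :=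
  congrArg Representation.IntertwiningMap.toLinearMap (Subsingleton.elim
    (LinearMap.intertwiningMap_of_isIntertwiningMap π σ f hf.isIntertwining) 0)

theorem intertwining_eq_smul_id [IsAlgClosed k] [FiniteDimensional k V] [π.IsIrreducible]
    {f : V →ₗ[k] V} (hf : Representation.IsIntertwiningMap π π f) :
    ∃ c : k, f = c • LinearMap.id := by
  obtain ⟨c, hc⟩ :=
    Representation.IsIrreducible.algebraMap_intertwiningMap_bijective_of_isAlgClosed.surjective
      (LinearMap.intertwiningMap_of_isIntertwiningMap π π f hf.isIntertwining)
  exact ⟨c, (congrArg Representation.IntertwiningMap.toLinearMap hc).symm⟩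

end Schur

section MultiplicityFree

variable {k V ι : Type*} [Field k] [AddCommGroup V] [Module k V] [FiniteDimensional k V]
  [Fintype ι] {D : ι → Type*} [∀ i, AddCommGroup (D i)] [∀ i, Module k (D i)]
  [∀ i, FiniteDimensional k (D i)] {κ : ∀ i, D i →ₗ[k] V} {Q : ∀ i, V →ₗ[k] D i}

theorem sum_comp_eq_id_of_biorthogonal
    (hsum : ∑ i, Module.finrank k (D i) = Module.finrank k V)
    (hself : ∀ i, Q i ∘ₗ κ i = LinearMap.id) (hne : Pairwise fun i j => Q i ∘ₗ κ j = 0) :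
    ∑ i, κ i ∘ₗ Q i = LinearMap.id := by
  classical
  have hleft : LinearMap.pi Q ∘ₗ LinearMap.lsum k D ℕ κ = LinearMap.id := by
    refine LinearMap.pi_ext' fun i => LinearMap.ext fun d => funext fun j => ?_
    have hQκ : Q j (κ i d) = (Pi.single i d : ∀ i, D i) j := by
      rcases eq_or_ne j i with rfl | hij
      · simpa using congrArg (· d) (hself j)
      · simpa [hij] using congrArg (· d) (hne hij)
    refine Eq.trans ?_ hQκ
    simp [LinearMap.lsum_piSingle, -LinearMap.lsum_apply]
  have hsurj : Function.Surjective (LinearMap.lsum k D ℕ κ) :=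
    (LinearMap.injective_iff_surjective_of_finrank_eq_finrank
      (by rw [Module.finrank_pi_fintype, hsum])).mp (LinearMap.injective_of_comp_eq_id _ _ hleft)
  have hright : LinearMap.lsum k D ℕ κ ∘ₗ LinearMap.pi Q = LinearMap.id := by
    rw [← LinearMap.cancel_right hsurj, LinearMap.comp_assoc, hleft]
    rfl
  rw [← hright]
  ext v
  simp

variable [IsAlgClosed k] {G : Type*} [Group G] {π : Representation k G V}
  {δ : ∀ i, Representation k G (D i)}

theorem intertwining_eq_sum_of_multiplicityFree [∀ i, (δ i).IsIrreducible]
    (hd : Pairwise fun i j => IsEmpty ((δ i).Equiv (δ j)))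
    (hsum : ∑ i, Module.finrank k (D i) = Module.finrank k V)
    (hκ : ∀ i, Representation.IsIntertwiningMap (δ i) π (κ i))
    (hQ : ∀ i, Representation.IsIntertwiningMap π (δ i) (Q i))
    (hQκ : ∀ i, Q i ∘ₗ κ i = LinearMap.id) {J : V →ₗ[k] V}
    (hJ : Representation.IsIntertwiningMap π π J) : ∃ c : ι → k, J = ∑ i, c i • κ i ∘ₗ Q i := by
  have hzero : ∀ {i j}, i ≠ j → ∀ {T : D j →ₗ[k] D i},
      Representation.IsIntertwiningMap (δ j) (δ i) T → T = 0 := fun hij _ hT =>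
    have := hd hij.symm
    intertwining_eq_zero hT
  have hid : ∑ i, κ i ∘ₗ Q i = LinearMap.id := sum_comp_eq_id_of_biorthogonal hsum hQκ
    fun i j hij => hzero hij (isIntertwiningMap_comp (hQ i) (hκ j))
  have hblock : ∀ i j, Representation.IsIntertwiningMap (δ j) (δ i) (Q i ∘ₗ J ∘ₗ κ j) :=
    fun i j => isIntertwiningMap_comp (hQ i) (isIntertwiningMap_comp hJ (hκ j))
  choose c hc using fun i => intertwining_eq_smul_id (hblock i i)
  refine ⟨c, ?_⟩
  calc J = (∑ i, κ i ∘ₗ Q i) ∘ₗ J ∘ₗ ∑ j, κ j ∘ₗ Q j := by rw [hid]; rfl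
    _ = ∑ i, ∑ j, κ i ∘ₗ (Q i ∘ₗ J ∘ₗ κ j) ∘ₗ Q j := by
      ext v
      simp [LinearMap.sum_apply]
    _ = ∑ i, c i • κ i ∘ₗ Q i := Finset.sum_congr rfl fun i _ => by
      rw [Finset.sum_eq_single i (fun j _ hji => ?_) (by simp), hc]
      · ext v
        simp
      · rw [hzero hji.symm (hblock i j), LinearMap.zero_comp, LinearMap.comp_zero]

end MultiplicityFree

section Kraus

variable {R H K N : Type*} [CommRing R] [AddCommGroup H] [Module R H] [AddCommGroup K] [Module R K]
  [AddCommGroup N] [Module R N]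

/-- The Kraus operators `v ↦ (id ⊗ ψ)(α v)` obtained from a Stinespring operator `α` by contracting
its second tensor factor with the functional `ψ`. -/
def kraus (α : H →ₗ[R] K ⊗[R] N) : Module.Dual R N →ₗ[R] (H →ₗ[R] K) where
  toFun ψ := contract K ψ ∘ₗ α
  map_add' ψ χ := by simp [contract, LinearMap.lTensor_add, LinearMap.comp_add, LinearMap.add_comp]
  map_smul' c ψ := by
    simp [contract, LinearMap.lTensor_smul, LinearMap.comp_smul, LinearMap.smul_comp]

theorem kraus_apply (α : H →ₗ[R] K ⊗[R] N) (ψ : Module.Dual R N) :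
    kraus α ψ = contract K ψ ∘ₗ α := rfl

/-- The transpose of `kraus` for the trace form: it pairs an operator `X : H → K` with the operators
`β (· ⊗ p) : K → H`. -/
def tracePairing (β : K ⊗[R] N →ₗ[R] H) : (H →ₗ[R] K) →ₗ[R] Module.Dual R N where
  toFun X :=
    { toFun := fun p => LinearMap.trace R H (β ∘ₗ (TensorProduct.mk R K N).flip p ∘ₗ X)
      map_add' := fun p q => by simp [LinearMap.comp_add, LinearMap.add_comp]
      map_smul' := fun c p => by simp [LinearMap.comp_smul, LinearMap.smul_comp] }
  map_add' X Y := by ext; simp [LinearMap.comp_add]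
  map_smul' c X := by ext; simp [LinearMap.comp_smul]

theorem tracePairing_apply (β : K ⊗[R] N →ₗ[R] H) (X : H →ₗ[R] K) (p : N) :
    tracePairing β X p = LinearMap.trace R H (β ∘ₗ (TensorProduct.mk R K N).flip p ∘ₗ X) := rfl

theorem sum_tracePairing_kraus {ι : Type*} [Fintype ι] (b : Module.Basis ι R N)
    (α : H →ₗ[R] K ⊗[R] N) (β : K ⊗[R] N →ₗ[R] H) :
    ∑ i, tracePairing β (kraus α (b.coord i)) (b i) = LinearMap.trace R H (β ∘ₗ α) := by
  conv_rhs => rw [← LinearMap.id_comp α, ← sum_mk_flip_comp_contract b]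
  simp only [tracePairing_apply, kraus_apply, ← map_sum]
  congr 1
  ext v
  simp [LinearMap.sum_apply]

variable {G : Type*} [Group G] {π : Representation R G H} {σ : Representation R G K}
  {τ : Representation R G N}

theorem trace_linHom (g : G) (A : Module.End R H) :
    LinearMap.trace R H (π.linHom π g A) = LinearMap.trace R H A := by
  have h : π.linHom π g A = π g * (A * π g⁻¹) := rfl
  rw [h, LinearMap.trace_mul_comm, mul_assoc, ← map_mul, inv_mul_cancel, map_one, mul_one]

theorem isIntertwiningMap_kraus {α : H →ₗ[R] K ⊗[R] N}
    (hα : Representation.IsIntertwiningMap π (σ.tprod τ) α) :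
    Representation.IsIntertwiningMap τ.dual (π.linHom σ) (kraus α) := by
  refine ⟨fun g ψ => LinearMap.ext fun v => ?_⟩
  have h : contract K (τ.dual g ψ) = σ g ∘ₗ contract K ψ ∘ₗ σ.tprod τ g⁻¹ :=
    TensorProduct.ext' fun x y => by
      simp [Representation.dual_apply, Module.Dual.transpose_apply, Representation.tprod_apply]
  rw [kraus_apply, h]
  simp [Representation.linHom_apply, kraus_apply, hα.isIntertwining]

theorem isIntertwiningMap_tracePairing {β : K ⊗[R] N →ₗ[R] H}
    (hβ : Representation.IsIntertwiningMap (σ.tprod τ) π β) :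
    Representation.IsIntertwiningMap (π.linHom σ) τ.dual (tracePairing β) := by
  refine ⟨fun g X => LinearMap.ext fun p => ?_⟩
  have h : β ∘ₗ (TensorProduct.mk R K N).flip p ∘ₗ π.linHom σ g X =
      π.linHom π g (β ∘ₗ (TensorProduct.mk R K N).flip (τ g⁻¹ p) ∘ₗ X) := by
    ext v
    simp [Representation.linHom_apply, ← hβ.isIntertwining, Representation.tprod_apply]
  rw [tracePairing_apply, h, trace_linHom]
  rfl

end Kraus

section Unitary

variable {G H K : Type*} [Group G] [NormedAddCommGroup H] [InnerProductSpace ℂ H]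
  [FiniteDimensional ℂ H] [NormedAddCommGroup K] [InnerProductSpace ℂ K] [FiniteDimensional ℂ K]
  {π : Representation ℂ G H} {σ : Representation ℂ G K}

/-- Unitarity of a representation on a finite dimensional inner product space. -/
def IsUnitary (π : Representation ℂ G H) : Prop := ∀ g, (π g).adjoint = π g⁻¹

theorem IsUnitary.tprod (hπ : IsUnitary π) (hσ : IsUnitary σ) : IsUnitary (π.tprod σ) := fun g => by
  rw [Representation.tprod_apply, Representation.tprod_apply, TensorProduct.adjoint_map, hπ, hσ]

theorem isIntertwiningMap_adjoint (hπ : IsUnitary π) (hσ : IsUnitary σ) {f : H →ₗ[ℂ] K}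
    (hf : Representation.IsIntertwiningMap π σ f) :
    Representation.IsIntertwiningMap σ π f.adjoint := by
  refine ⟨fun g v => ext_inner_left ℂ fun w => ?_⟩
  rw [LinearMap.adjoint_inner_right, ← LinearMap.adjoint_inner_left, hσ, ← hf.isIntertwining,
    ← LinearMap.adjoint_inner_right, ← hπ, LinearMap.adjoint_inner_left]

end Unitary

section Stinespring

variable {H K N : Type*} [NormedAddCommGroup H] [InnerProductSpace ℂ H] [FiniteDimensional ℂ H]
  [NormedAddCommGroup K] [InnerProductSpace ℂ K] [FiniteDimensional ℂ K]
  [NormedAddCommGroup N] [InnerProductSpace ℂ N] [FiniteDimensional ℂ N]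

/-- The map `A ↦ Tr_N(α A α*)` with Stinespring operator `α : H → K ⊗ N`. -/
def stinespring (α : H →ₗ[ℂ] K ⊗[ℂ] N) : Module.End ℂ H →ₗ[ℂ] Module.End ℂ K where
  toFun A := partialTrace K N (α ∘ₗ A ∘ₗ α.adjoint)
  map_add' A B := by simp [LinearMap.add_comp, LinearMap.comp_add]
  map_smul' c A := by simp [LinearMap.smul_comp, LinearMap.comp_smul]

theorem stinespring_apply (α : H →ₗ[ℂ] K ⊗[ℂ] N) (A : Module.End ℂ H) :
    stinespring α A = partialTrace K N (α ∘ₗ A ∘ₗ α.adjoint) := rfl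

theorem trace_stinespring {α : H →ₗ[ℂ] K ⊗[ℂ] N} (hα : α.adjoint ∘ₗ α = LinearMap.id)
    (A : Module.End ℂ H) : LinearMap.trace ℂ K (stinespring α A) = LinearMap.trace ℂ H A := by
  rw [stinespring_apply, ← LinearMap.comp_apply, trace_comp_partialTrace,
    LinearMap.trace_comp_comm', LinearMap.comp_assoc, hα, LinearMap.comp_id]

theorem adjoint_kraus_innerSL (α : H →ₗ[ℂ] K ⊗[ℂ] N) (w : N) :
    (kraus α (innerSL ℂ w).toLinearMap).adjoint =
      α.adjoint ∘ₗ (TensorProduct.mk ℂ K N).flip w := by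
  rw [kraus_apply, LinearMap.adjoint_comp]
  congr 1
  rw [eq_comm, LinearMap.eq_adjoint_iff]
  intro z t
  induction t with
  | zero => simp
  | add s t hs ht => rw [inner_add_right, hs, ht, map_add, inner_add_right]
  | tmul x y => simp [inner_smul_right, mul_comm]

theorem stinespring_apply_eq_sum_kraus {ι : Type*} [Fintype ι] (b : OrthonormalBasis ι ℂ N)
    (α : H →ₗ[ℂ] K ⊗[ℂ] N) (A : Module.End ℂ H) :
    stinespring α A =
      ∑ i, kraus α (b.toBasis.coord i) ∘ₗ A ∘ₗ (kraus α (b.toBasis.coord i)).adjoint := by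
  rw [stinespring_apply, partialTrace_eq_sum b.toBasis]
  refine Finset.sum_congr rfl fun i _ => ?_
  rw [coord_toBasis_eq_innerSL, adjoint_kraus_innerSL, OrthonormalBasis.coe_toBasis]
  rfl

theorem isCompletelyPositive_stinespring [CompleteSpace H] [CompleteSpace K]
    (α : H →ₗ[ℂ] K ⊗[ℂ] N) : IsCompletelyPositive (stinespring α) :=
  isCompletelyPositive_of_kraus _ (stinespring_apply_eq_sum_kraus (stdOrthonormalBasis ℂ N) α)

theorem choi_stinespring (α : H →ₗ[ℂ] K ⊗[ℂ] N) :
    choi (stinespring α) = kraus α ∘ₗ tracePairing α.adjoint := by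
  let b := stdOrthonormalBasis ℂ N
  ext1 X
  rw [choi_apply_of_kraus (stinespring_apply_eq_sum_kraus b α), LinearMap.comp_apply,
    ← b.toBasis.sum_dual_apply_smul_coord (tracePairing α.adjoint X), map_sum]
  refine Finset.sum_congr rfl fun i _ => ?_
  rw [map_smul, coord_toBasis_eq_innerSL, adjoint_kraus_innerSL, OrthonormalBasis.coe_toBasis]
  rfl

theorem IsCompletelyPositive.tracePairing_choi_kraus_nonneg [CompleteSpace H] [CompleteSpace K]
    {Φ : Module.End ℂ H →ₗ[ℂ] Module.End ℂ K} (hΦ : IsCompletelyPositive Φ)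
    (α : H →ₗ[ℂ] K ⊗[ℂ] N) (w : N) :
    0 ≤ tracePairing α.adjoint (choi Φ (kraus α (innerSL ℂ w).toLinearMap)) w := by
  have h := hΦ.trace_adjoint_comp_choi_nonneg (kraus α (innerSL ℂ w).toLinearMap)
  rwa [adjoint_kraus_innerSL] at h

variable {G : Type*} [Group G] {π : Representation ℂ G H} {σ : Representation ℂ G K}
  {τ : Representation ℂ G N}

theorem isEquivariant_stinespring {α : H →ₗ[ℂ] K ⊗[ℂ] N}
    (hα : Representation.IsIntertwiningMap π (σ.tprod τ) α)
    (hα' : Representation.IsIntertwiningMap (σ.tprod τ) π α.adjoint) :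
    IsEquivariant π σ (stinespring α) := by
  have hconj : ∀ g A, α ∘ₗ π.linHom π g A ∘ₗ α.adjoint =
      (σ.tprod τ).linHom (σ.tprod τ) g (α ∘ₗ A ∘ₗ α.adjoint) := fun g A => by
    refine LinearMap.ext fun t => ?_
    simp only [Representation.linHom_apply, LinearMap.comp_apply, hα.isIntertwining,
      hα'.isIntertwining]
  have hmap : ∀ g B C, (σ.tprod τ).linHom (σ.tprod τ) g (TensorProduct.map B C) =
      TensorProduct.map (σ.linHom σ g B) (τ.linHom τ g C) := fun g B C =>
    TensorProduct.ext' fun x y => by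
      simp [Representation.linHom_apply, Representation.tprod_apply]
  have htr : ∀ g, partialTrace K N ∘ₗ (σ.tprod τ).linHom (σ.tprod τ) g =
      σ.linHom σ g ∘ₗ partialTrace K N := fun g => linearMap_ext_tensorMap fun B C => by
    rw [LinearMap.comp_apply, LinearMap.comp_apply, hmap, partialTrace_map, partialTrace_map,
      trace_linHom, map_smul]
  refine ⟨fun g A => ?_⟩
  rw [stinespring_apply, stinespring_apply, hconj]
  exact congrArg (fun F => F (α ∘ₗ A ∘ₗ α.adjoint)) (htr g)

theorem tracePairing_comp_kraus [τ.IsIrreducible] {α : H →ₗ[ℂ] K ⊗[ℂ] N}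
    (hα : Representation.IsIntertwiningMap π (σ.tprod τ) α)
    (hα' : Representation.IsIntertwiningMap (σ.tprod τ) π α.adjoint)
    (hiso : α.adjoint ∘ₗ α = LinearMap.id) :
    tracePairing α.adjoint ∘ₗ kraus α =
      (Module.finrank ℂ H / Module.finrank ℂ N : ℂ) • LinearMap.id := by
  obtain ⟨_, -⟩ := isIrreducible_iff_invariant.mp ‹τ.IsIrreducible›
  have := isIrreducible_dual ‹τ.IsIrreducible›
  obtain ⟨c, hc⟩ := intertwining_eq_smul_id
    (isIntertwiningMap_comp (isIntertwiningMap_tracePairing hα') (isIntertwiningMap_kraus hα))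
  let b := Module.finBasis ℂ N
  have htrace : Module.finrank ℂ N * c = Module.finrank ℂ H := by
    calc (Module.finrank ℂ N * c : ℂ) = ∑ i, (c • b.coord i) (b i) := by simp
      _ = ∑ i, tracePairing α.adjoint (kraus α (b.coord i)) (b i) :=
        Finset.sum_congr rfl fun i _ => congrArg (fun F => F (b.coord i) (b i)) hc.symm
      _ = Module.finrank ℂ H := by
        rw [sum_tracePairing_kraus, hiso, LinearMap.trace_id]
  have hN : (Module.finrank ℂ N : ℂ) ≠ 0 := Nat.cast_ne_zero.mpr Module.finrank_pos.ne'
  rw [hc, ← htrace, mul_div_cancel_left₀ _ hN]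

end Stinespring

section Covariant

variable {G H K : Type*} [Group G]
  [NormedAddCommGroup H] [InnerProductSpace ℂ H] [FiniteDimensional ℂ H]
  [NormedAddCommGroup K] [InnerProductSpace ℂ K] [FiniteDimensional ℂ K]

/-- The space of all equivariant linear maps `End(H) → End(K)`. -/
def equivariantMaps (π : Representation ℂ G H) (σ : Representation ℂ G K) :
    Submodule ℂ (Module.End ℂ H →ₗ[ℂ] Module.End ℂ K) where
  carrier := {Φ | IsEquivariant π σ Φ}
  zero_mem' := ⟨fun g A => by simp⟩
  add_mem' hΦ hΨ := ⟨fun g A => by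
    rw [LinearMap.add_apply, hΦ.isIntertwining, hΨ.isIntertwining, LinearMap.add_apply, map_add]⟩
  smul_mem' c Φ hΦ := ⟨fun g A => by
    rw [LinearMap.smul_apply, hΦ.isIntertwining, LinearMap.smul_apply, map_smul]⟩

theorem convex_isIrreduciblyCovariantChannel [CompleteSpace H] [CompleteSpace K]
    (π : Representation ℂ G H) (σ : Representation ℂ G K) :
    Convex ℝ {Φ | IsIrreduciblyCovariantChannel π σ Φ} := by
  intro Φ hΦ Ψ hΨ a b ha hb hab
  refine ⟨hΦ.irreducible_source, hΦ.irreducible_target, ⟨?_, fun A => ?_⟩,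
    (equivariantMaps π σ).add_mem ((equivariantMaps π σ).smul_mem (a : ℂ) hΦ.isEquivariant)
      ((equivariantMaps π σ).smul_mem (b : ℂ) hΨ.isEquivariant)⟩
  · exact (hΦ.isQuantumChannel.completelyPositive.smul ha).add
      (hΨ.isQuantumChannel.completelyPositive.smul hb)
  · rw [LinearMap.add_apply, LinearMap.smul_apply, LinearMap.smul_apply, map_add,
      LinearMap.map_smul_of_tower, LinearMap.map_smul_of_tower,
      hΦ.isQuantumChannel.trace_preserving, hΨ.isQuantumChannel.trace_preserving, ← add_smul, hab,
      one_smul]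

variable {ι : Type*} [Fintype ι] {N : ι → Type*} [∀ i, NormedAddCommGroup (N i)]
  [∀ i, InnerProductSpace ℂ (N i)] [∀ i, FiniteDimensional ℂ (N i)]

/-- Intertwining isometries `α i : H → K ⊗ N i` into pairwise inequivalent irreducible second
factors which, by the dimension count, exhaust `Hom(H, K)`. For `SU(2)` this is the Clebsch-Gordan
decomposition. -/
structure IsClebschGordanSystem (π : Representation ℂ G H) (σ : Representation ℂ G K)
    (τ : ∀ i, Representation ℂ G (N i)) (α : ∀ i, H →ₗ[ℂ] K ⊗[ℂ] N i) : Prop where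
  irreducible : ∀ i, (τ i).IsIrreducible
  inequivalent : Pairwise fun i j => IsEmpty ((τ i).Equiv (τ j))
  intertwining : ∀ i, Representation.IsIntertwiningMap π (σ.tprod (τ i)) (α i)
  intertwining_adjoint : ∀ i, Representation.IsIntertwiningMap (σ.tprod (τ i)) π (α i).adjoint
  isometry : ∀ i, (α i).adjoint ∘ₗ α i = LinearMap.id
  sum_finrank : ∑ i, Module.finrank ℂ (N i) = Module.finrank ℂ H * Module.finrank ℂ K

variable {π : Representation ℂ G H} {σ : Representation ℂ G K}
  {τ : ∀ i, Representation ℂ G (N i)} {α : ∀ i, H →ₗ[ℂ] K ⊗[ℂ] N i}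

namespace IsClebschGordanSystem

theorem finrank_ne_zero (h : IsClebschGordanSystem π σ τ α) (i : ι) :
    (Module.finrank ℂ (N i) : ℂ) ≠ 0 := by
  obtain ⟨_, -⟩ := isIrreducible_iff_invariant.mp (h.irreducible i)
  exact Nat.cast_ne_zero.mpr Module.finrank_pos.ne'

theorem tracePairing_comp_kraus_self (h : IsClebschGordanSystem π σ τ α) (i : ι) :
    tracePairing (α i).adjoint ∘ₗ kraus (α i) =
      (Module.finrank ℂ H / Module.finrank ℂ (N i) : ℂ) • LinearMap.id :=
  have := h.irreducible i
  tracePairing_comp_kraus (h.intertwining i) (h.intertwining_adjoint i) (h.isometry i)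

theorem tracePairing_comp_kraus_of_ne (h : IsClebschGordanSystem π σ τ α) {i j : ι}
    (hij : i ≠ j) : tracePairing (α j).adjoint ∘ₗ kraus (α i) = 0 := by
  have := isIrreducible_dual (h.irreducible i)
  have := isIrreducible_dual (h.irreducible j)
  have := isEmpty_equiv_dual (h.inequivalent hij.symm)
  exact intertwining_eq_zero (isIntertwiningMap_comp
    (isIntertwiningMap_tracePairing (h.intertwining_adjoint j))
    (isIntertwiningMap_kraus (h.intertwining i)))

theorem exists_eq_sum [Nontrivial H] (h : IsClebschGordanSystem π σ τ α)
    {Φ : Module.End ℂ H →ₗ[ℂ] Module.End ℂ K} (hΦ : IsEquivariant π σ Φ) :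
    ∃ c : ι → ℂ, Φ = ∑ i, c i • stinespring (α i) := by
  have hH : (Module.finrank ℂ H : ℂ) ≠ 0 := Nat.cast_ne_zero.mpr Module.finrank_pos.ne'
  have hirr : ∀ i, (τ i).dual.IsIrreducible := fun i => isIrreducible_dual (h.irreducible i)
  let Q : ∀ i, (H →ₗ[ℂ] K) →ₗ[ℂ] Module.Dual ℂ (N i) := fun i =>
    (Module.finrank ℂ (N i) / Module.finrank ℂ H : ℂ) • tracePairing (α i).adjoint
  have hQκ : ∀ i, Q i ∘ₗ kraus (α i) = LinearMap.id := fun i => by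
    rw [LinearMap.smul_comp, h.tracePairing_comp_kraus_self, smul_smul,
      div_mul_div_cancel₀ hH, div_self (h.finrank_ne_zero i), one_smul]
  have hQ : ∀ i, Representation.IsIntertwiningMap (π.linHom σ) (τ i).dual (Q i) := fun i =>
    ⟨fun g X => by
      rw [LinearMap.smul_apply, LinearMap.smul_apply, map_smul,
        (isIntertwiningMap_tracePairing (h.intertwining_adjoint i)).isIntertwining]⟩
  obtain ⟨c, hc⟩ := intertwining_eq_sum_of_multiplicityFree
    (fun i j hij => isEmpty_equiv_dual (h.inequivalent hij.symm))
    (by simp only [Subspace.dual_finrank_eq, h.sum_finrank, Module.finrank_linearMap])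
    (fun i => isIntertwiningMap_kraus (h.intertwining i)) hQ hQκ (isIntertwiningMap_choi hΦ)
  refine ⟨fun i => c i * (Module.finrank ℂ (N i) / Module.finrank ℂ H), choi_injective ?_⟩
  rw [hc, map_sum]
  refine Finset.sum_congr rfl fun i _ => ?_
  rw [map_smul, choi_stinespring, mul_smul, LinearMap.comp_smul]

theorem span_stinespring [Nontrivial H] (h : IsClebschGordanSystem π σ τ α) :
    Submodule.span ℂ (Set.range fun i => stinespring (α i)) = equivariantMaps π σ := by
  refine le_antisymm (Submodule.span_le.mpr ?_) fun Φ hΦ => ?_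
  · rintro _ ⟨i, rfl⟩
    exact isEquivariant_stinespring (h.intertwining i) (h.intertwining_adjoint i)
  · obtain ⟨c, rfl⟩ := h.exists_eq_sum hΦ
    exact Submodule.sum_mem _ fun i _ =>
      Submodule.smul_mem _ _ (Submodule.subset_span (Set.mem_range_self i))

theorem tracePairing_choi_sum_kraus (h : IsClebschGordanSystem π σ τ α) (c : ι → ℂ) (j : ι)
    (φ : Module.Dual ℂ (N j)) :
    tracePairing (α j).adjoint (choi (∑ i, c i • stinespring (α i)) (kraus (α j) φ)) =
      (c j * (Module.finrank ℂ H / Module.finrank ℂ (N j)) ^ 2) • φ := by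
  have hself := fun ψ => congrArg (· ψ) (h.tracePairing_comp_kraus_self j)
  have hne := fun {i} (hij : i ≠ j) ψ => congrArg (· ψ) (h.tracePairing_comp_kraus_of_ne hij)
  simp only [LinearMap.comp_apply, LinearMap.smul_apply, LinearMap.id_apply,
    LinearMap.zero_apply] at hself hne
  simp only [map_sum, map_smul, choi_stinespring, LinearMap.sum_apply, LinearMap.smul_apply,
    LinearMap.comp_apply]
  rw [Finset.sum_eq_single_of_mem j (Finset.mem_univ j) fun i _ hij => by
    rw [hne hij, smul_zero]]
  simp only [hself, map_smul, smul_smul, sq]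

theorem coeff_nonneg [CompleteSpace H] [CompleteSpace K] [Nontrivial H]
    (h : IsClebschGordanSystem π σ τ α) {c : ι → ℂ}
    (hc : IsCompletelyPositive (∑ i, c i • stinespring (α i))) (j : ι) : 0 ≤ c j := by
  obtain ⟨_, -⟩ := isIrreducible_iff_invariant.mp (h.irreducible j)
  obtain ⟨w, hw⟩ := exists_norm_eq (N j) zero_le_one
  have hpos : (0 : ℂ) < (Module.finrank ℂ H / Module.finrank ℂ (N j)) ^ 2 :=
    pow_pos (div_pos (mod_cast Module.finrank_pos) (mod_cast Module.finrank_pos)) 2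
  have hnonneg := hc.tracePairing_choi_kraus_nonneg (α j) w
  have hφ : (innerSL ℂ w).toLinearMap w = 1 := by simp [hw]
  rw [h.tracePairing_choi_sum_kraus, LinearMap.smul_apply, hφ, smul_eq_mul, mul_one] at hnonneg
  calc 0 ≤ c j * _ * _ := mul_nonneg hnonneg (inv_nonneg.mpr hpos.le)
    _ = c j := mul_inv_cancel_right₀ hpos.ne' _

theorem sum_coeff_eq_one [Nontrivial H] (h : IsClebschGordanSystem π σ τ α) {c : ι → ℂ}
    (hc : ∀ A, LinearMap.trace ℂ K ((∑ i, c i • stinespring (α i)) A) = LinearMap.trace ℂ H A) :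
    ∑ i, c i = 1 := by
  have htrace : (∑ i, c i) * LinearMap.trace ℂ H LinearMap.id =
      1 * LinearMap.trace ℂ H LinearMap.id := by
    rw [one_mul]
    refine Eq.trans ?_ (hc LinearMap.id)
    simp only [LinearMap.sum_apply, LinearMap.smul_apply, map_sum, map_smul, Finset.sum_mul,
      trace_stinespring (h.isometry _), smul_eq_mul]
  refine mul_right_cancel₀ ?_ htrace
  rw [LinearMap.trace_id]
  exact Nat.cast_ne_zero.mpr Module.finrank_pos.ne'

variable [CompleteSpace H] [CompleteSpace K]

theorem isIrreduciblyCovariantChannel_stinespring (h : IsClebschGordanSystem π σ τ α)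
    (hπ : π.IsIrreducible) (hσ : σ.IsIrreducible) (i : ι) :
    IsIrreduciblyCovariantChannel π σ (stinespring (α i)) where
  irreducible_source := hπ
  irreducible_target := hσ
  isQuantumChannel :=
    ⟨isCompletelyPositive_stinespring (α i), trace_stinespring (h.isometry i)⟩
  isEquivariant := isEquivariant_stinespring (h.intertwining i) (h.intertwining_adjoint i)

theorem convexHull_stinespring (h : IsClebschGordanSystem π σ τ α) (hπ : π.IsIrreducible)
    (hσ : σ.IsIrreducible) :
    convexHull ℝ (Set.range fun i => stinespring (α i)) =
      {Φ | IsIrreduciblyCovariantChannel π σ Φ} := by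
  refine Set.Subset.antisymm
    (convexHull_min ?_ (convex_isIrreduciblyCovariantChannel π σ)) fun Φ hΦ => ?_
  · rintro _ ⟨i, rfl⟩
    exact h.isIrreduciblyCovariantChannel_stinespring hπ hσ i
  obtain ⟨_, -⟩ := isIrreducible_iff_invariant.mp hπ
  obtain ⟨c, rfl⟩ := h.exists_eq_sum hΦ.isEquivariant
  have hnonneg := h.coeff_nonneg hΦ.isQuantumChannel.completelyPositive
  have hone := h.sum_coeff_eq_one hΦ.isQuantumChannel.trace_preserving
  have hre : ∀ i, c i • stinespring (α i) = (c i).re • stinespring (α i) := fun i => by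
    have hci : c i = ((c i).re : ℂ) := Complex.eq_re_of_ofReal_le (r := 0) (mod_cast hnonneg i)
    conv_lhs => rw [hci]
    rfl
  simp only [hre]
  exact (convex_convexHull ℝ _).sum_mem (fun i _ => (Complex.nonneg_iff.mp (hnonneg i)).1)
    (by rw [← Complex.re_sum, hone, Complex.one_re])
    fun i _ => subset_convexHull ℝ _ (Set.mem_range_self i)

end IsClebschGordanSystem

end Covariant

section Forms

open MvPolynomial

variable {m : ℕ}

/-- The coefficient of `x₁ˡ x₂ᵐ⁻ˡ` in a binary form of degree `m`. -/
def formCoeff (m l : ℕ) : P m →ₗ[ℂ] ℂ := lcoeff ℂ (expo m l) ∘ₗ incl m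

/-- The form `x₁ˡ x₂ᵐ⁻ˡ`, meaningful for `l ≤ m`. -/
def mono (m l : ℕ) : P m := homComp m (X 0 ^ l * X 1 ^ (m - l))

/-- The `m`-th power of the linear form `a₁ x₁ + a₂ x₂`. Up to the factor `m!` these are the
reproducing kernels of `P m`, see `inner_linPow`. -/
def linPow (m : ℕ) (a : Fin 2 → ℂ) : P m := homComp m ((∑ i, C (a i) * X i) ^ m)

theorem incl_homComp {p : MvPolynomial (Fin 2) ℂ} (hp : p.IsHomogeneous m) :
    incl m (homComp m p) = p :=
  homogeneousComponent_eq_self hp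

theorem incl_mono {l : ℕ} (h : l ≤ m) : incl m (mono m l) = X 0 ^ l * X 1 ^ (m - l) := by
  have hom := (isHomogeneous_X_pow (R := ℂ) (0 : Fin 2) l).mul
    (isHomogeneous_X_pow (R := ℂ) (1 : Fin 2) (m - l))
  rw [Nat.add_sub_of_le h] at hom
  exact incl_homComp hom

theorem incl_linPow (m : ℕ) (a : Fin 2 → ℂ) : incl m (linPow m a) = (∑ i, C (a i) * X i) ^ m := by
  have hom : (∑ i, C (a i) * X i : MvPolynomial (Fin 2) ℂ).IsHomogeneous 1 :=
    IsHomogeneous.sum _ _ _ fun i _ => isHomogeneous_C_mul_X _ i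
  exact incl_homComp (by simpa using hom.pow m)

theorem monomial_expo (m l : ℕ) : monomial (expo m l) (1 : ℂ) = X 0 ^ l * X 1 ^ (m - l) := by
  rw [expo, monomial_single_add, ← X_pow_eq_monomial]

theorem expo_injective (m : ℕ) : Function.Injective (expo m) := fun a b h => by
  simpa [expo] using DFunLike.congr_fun h 0

theorem formCoeff_mono {l : ℕ} (h : l ≤ m) (k : ℕ) :
    formCoeff m k (mono m l) = if k = l then 1 else 0 := by
  simp [formCoeff, incl_mono h, ← monomial_expo, coeff_monomial, (expo_injective m).eq_iff,
    eq_comm]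

theorem formCoeff_sum_smul_mono {k : ℕ} (hk : k ≤ m) (c : ℕ → ℂ) :
    formCoeff m k (∑ l ∈ Finset.range (m + 1), c l • mono m l) = c k := by
  rw [map_sum, Finset.sum_eq_single_of_mem k (Finset.mem_range_succ_iff.mpr hk)]
  · simp [formCoeff_mono hk]
  · intro l hl hlk
    simp [formCoeff_mono (Finset.mem_range_succ_iff.mp hl), hlk.symm]

theorem form_ext {f g : P m} (h : ∀ l ≤ m, formCoeff m l f = formCoeff m l g) : f = g := by
  refine incl_injective m (MvPolynomial.ext _ _ fun d => ?_)
  by_cases hd : d.degree = m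
  · obtain ⟨hlt, hexpo⟩ := expo_of_degree hd
    rw [← hexpo]
    exact h _ (Nat.lt_succ_iff.mp hlt)
  · rw [(incl_isHomogeneous f).coeff_eq_zero hd, (incl_isHomogeneous g).coeff_eq_zero hd]

theorem sum_formCoeff_smul_mono (f : P m) :
    ∑ l ∈ Finset.range (m + 1), formCoeff m l f • mono m l = f :=
  form_ext fun _ hk => formCoeff_sum_smul_mono hk fun l => formCoeff m l f

theorem finrank_P (m : ℕ) : Module.finrank ℂ (P m) = m + 1 := by
  let e : P m →ₗ[ℂ] Fin (m + 1) → ℂ := LinearMap.pi fun l => formCoeff m l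
  have he : Function.Bijective e := by
    refine ⟨fun f g h => form_ext fun l hl => congrFun h ⟨l, Nat.lt_succ_of_le hl⟩, fun c =>
      ⟨∑ l ∈ Finset.range (m + 1), Function.extend Fin.val c 0 l • mono m l, funext fun k => ?_⟩⟩
    exact (formCoeff_sum_smul_mono k.is_le _).trans (Fin.val_injective.extend_apply c 0 k)
  rw [(LinearEquiv.ofBijective e he).finrank_eq, Module.finrank_fin_fun]

theorem formCoeff_linPow {l : ℕ} (h : l ≤ m) (a : Fin 2 → ℂ) :
    formCoeff m l (linPow m a) = a 0 ^ l * a 1 ^ (m - l) * m.choose l := by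
  have expansion : linPow m a =
      ∑ l ∈ Finset.range (m + 1), (a 0 ^ l * a 1 ^ (m - l) * m.choose l) • mono m l := by
    apply incl_injective
    rw [incl_linPow, Fin.sum_univ_two, add_pow, map_sum]
    refine Finset.sum_congr rfl fun l hl => ?_
    rw [map_smul, incl_mono (Finset.mem_range_succ_iff.mp hl), smul_eq_C_mul]
    simp only [mul_pow, C_mul, C_pow, map_natCast]
    ring
  rw [expansion, formCoeff_sum_smul_mono h fun l => a 0 ^ l * a 1 ^ (m - l) * m.choose l]

theorem inner_eq_sum_formCoeff (f g : P m) :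
    inner ℂ f g = ∑ l ∈ Finset.range (m + 1), ((l.factorial * (m - l).factorial : ℕ) : ℂ) *
      (star (formCoeff m l f) * formCoeff m l g) := rfl

theorem inner_mono {l k : ℕ} (hl : l ≤ m) (hk : k ≤ m) :
    inner ℂ (mono m l) (mono m k) =
      if l = k then ((l.factorial * (m - l).factorial : ℕ) : ℂ) else 0 := by
  rw [inner_eq_sum_formCoeff,
    Finset.sum_eq_single_of_mem l (Finset.mem_range_succ_iff.mpr hl)]
  · simp [formCoeff_mono hl, formCoeff_mono hk]
  · intro j _ hj
    simp [formCoeff_mono hl, hj]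

theorem eval_incl (f : P m) (a : Fin 2 → ℂ) :
    eval a (incl m f) =
      ∑ l ∈ Finset.range (m + 1), formCoeff m l f * (a 0 ^ l * a 1 ^ (m - l)) := by
  conv_lhs => rw [← sum_formCoeff_smul_mono f]
  rw [map_sum, map_sum]
  refine Finset.sum_congr rfl fun l hl => ?_
  rw [map_smul, incl_mono (Finset.mem_range_succ_iff.mp hl)]
  simp [smul_eq_C_mul]

theorem inner_linPow (f : P m) (a : Fin 2 → ℂ) :
    inner ℂ f (linPow m a) = m.factorial * star (eval (star a) (incl m f)) := by
  rw [inner_eq_sum_formCoeff, eval_incl, star_sum, Finset.mul_sum]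
  refine Finset.sum_congr rfl fun l hl => ?_
  have hlm := Finset.mem_range_succ_iff.mp hl
  rw [formCoeff_linPow hlm, ← Nat.choose_mul_factorial_mul_factorial hlm]
  simp only [star_mul', star_pow, Pi.star_apply, star_star]
  push_cast
  ring

theorem ext_inner_linPow {f g : P m}
    (h : ∀ a, inner ℂ f (linPow m a) = inner ℂ g (linPow m a)) : f = g := by
  refine incl_injective m (MvPolynomial.funext fun a => ?_)
  have hstar := h (star a)
  rw [inner_linPow, inner_linPow, star_star] at hstar
  exact star_injective (mul_left_cancel₀ (Nat.cast_ne_zero.mpr m.factorial_ne_zero) hstar)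

end Forms

section Unitarity

open MvPolynomial

variable {m : ℕ}

theorem eval_subst (g : Matrix (Fin 2) (Fin 2) ℂ) (a : Fin 2 → ℂ) (p : MvPolynomial (Fin 2) ℂ) :
    eval a (subst g p) = eval (Matrix.vecMul a g) p := by
  have hcomp : (aeval a).comp (subst g) = (aeval (Matrix.vecMul a g) : _ →ₐ[ℂ] ℂ) := by
    ext1 j
    simp [subst, Matrix.vecMul, dotProduct, mul_comm]
  simpa [aeval_eq_eval] using DFunLike.congr_fun hcomp p

theorem rho_linPow (g : SU2) (a : Fin 2 → ℂ) :
    rho m g (linPow m a) = linPow m (Matrix.mulVec g.1 a) := by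
  apply incl_injective
  rw [incl_rho, incl_linPow, incl_linPow, map_pow]
  congr 1
  simp only [subst, Fin.sum_univ_two, map_add, map_mul, aeval_X, algHom_C, algebraMap_eq,
    Matrix.mulVec, dotProduct]
  ring

theorem inner_rho_rho_linPow (g : SU2) (f : P m) (a : Fin 2 → ℂ) :
    inner ℂ (rho m g f) (rho m g (linPow m a)) = inner ℂ f (linPow m a) := by
  have unitary : g.1.conjTranspose * g.1 = 1 := Matrix.mem_unitaryGroup_iff'.mp g.2.1
  rw [rho_linPow, inner_linPow, inner_linPow, incl_rho, eval_subst, Matrix.star_mulVec,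
    Matrix.vecMul_vecMul, unitary, Matrix.vecMul_one]

theorem isUnitary_rho (m : ℕ) : IsUnitary (rho m) := by
  intro g
  ext1 f
  refine ext_inner_linPow fun a => ?_
  rw [LinearMap.adjoint_inner_left, ← inner_rho_rho_linPow g (rho m g⁻¹ f),
    Representation.self_inv_apply]

end Unitarity

section Irreducibility

theorem mem_of_sum_mem_of_eigenvectors {k V ι : Type*} [Field k] [AddCommGroup V] [Module k V]
    {T : Module.End k V} {S : Submodule k V} (hS : ∀ v ∈ S, T v ∈ S) {s : Finset ι} {μ : ι → k}
    (hμ : Set.InjOn μ s) {v : ι → V} (hv : ∀ i ∈ s, T (v i) = μ i • v i)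
    (hsum : ∑ i ∈ s, v i ∈ S) {i : ι} (hi : i ∈ s) : v i ∈ S := by
  classical
  have projection : Polynomial.aeval T (Lagrange.basis s μ i) (∑ j ∈ s, v j) = v i := by
    rw [map_sum, Finset.sum_eq_single_of_mem i hi]
    · rw [Module.End.aeval_apply_of_mem_apply_eq_smul (hv i hi),
        Lagrange.eval_basis_self hμ hi, one_smul]
    · intro j hj hji
      rw [Module.End.aeval_apply_of_mem_apply_eq_smul (hv j hj),
        Lagrange.eval_basis_of_ne hji.symm hj, zero_smul]
  rw [← projection]
  exact Polynomial.aeval_apply_smul_mem_of_le_comap' hsum _ T hS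

/-- The element of `SU(2)` with first row `(a, b)`. -/
def ofPair (a b : ℂ) (h : a * star a + b * star b = 1) : SU2 :=
  ⟨!![a, b; -star b, star a], by
    rw [Matrix.mem_specialUnitaryGroup_iff, Matrix.mem_unitaryGroup_iff]
    constructor
    · ext i j
      fin_cases i <;> fin_cases j <;>
        simp [Matrix.mul_apply, Fin.sum_univ_two, Matrix.star_apply, mul_comm] <;>
        rw [RCLike.star_def] at h <;>
        linear_combination h
    · rw [Matrix.det_fin_two_of]
      linear_combination h⟩

theorem rho_ofPair_diag_mono {m l : ℕ} (hl : l ≤ m) {t : ℂ} (ht : t * star t + 0 * star 0 = 1) :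
    rho m (ofPair t 0 ht) (mono m l) = (t ^ l * star t ^ (m - l)) • mono m l := by
  apply incl_injective
  rw [incl_rho, map_smul, incl_mono hl, MvPolynomial.smul_eq_C_mul]
  simp only [subst, ofPair, Fin.sum_univ_two, map_mul, map_pow, MvPolynomial.aeval_X,
    Matrix.of_apply, Matrix.cons_val', Matrix.cons_val_zero, Matrix.cons_val_one,
    Matrix.cons_val_fin_one, star_zero, neg_zero, map_zero, zero_mul, add_zero, zero_add, mul_pow]
  ring

theorem exists_injOn_pow_mul_star_pow (m : ℕ) :
    ∃ t : ℂ, t * star t = 1 ∧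
      Set.InjOn (fun l => t ^ l * star t ^ (m - l)) (Finset.range (m + 1)) := by
  obtain ⟨t, ht⟩ : ∃ t : ℂ, IsPrimitiveRoot t (2 * (m + 1)) :=
    ⟨_, Complex.isPrimitiveRoot_exp _ (by simp)⟩
  have unit : t * star t = 1 := by
    simp [Complex.mul_conj', Complex.norm_eq_one_of_pow_eq_one ht.pow_eq_one (by simp)]
  have eigenvalue_mul : ∀ l ∈ Finset.range (m + 1), t ^ l * star t ^ (m - l) * t ^ m =
      t ^ (2 * l) := by
    intro l hl
    calc t ^ l * star t ^ (m - l) * t ^ m = (t * star t) ^ (m - l) * t ^ (2 * l) := by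
          rw [← Nat.sub_add_cancel (Finset.mem_range_succ_iff.mp hl), Nat.add_sub_cancel]
          ring
      _ = t ^ (2 * l) := by rw [unit, one_pow, one_mul]
  refine ⟨t, unit, fun a ha b hb hab => ?_⟩
  have hpow : t ^ (2 * a) = t ^ (2 * b) := by
    rw [← eigenvalue_mul a ha, ← eigenvalue_mul b hb]
    exact congrArg (· * t ^ m) hab
  rw [Finset.mem_coe, Finset.mem_range] at ha hb
  exact Nat.mul_left_cancel two_pos (ht.pow_inj (by omega) (by omega) hpow)

variable {m : ℕ} {S : Submodule ℂ (P m)}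

theorem mono_mem_of_formCoeff_ne_zero (hS : ∀ g, ∀ f ∈ S, rho m g f ∈ S) {f : P m} (hf : f ∈ S)
    {l : ℕ} (hl : l ≤ m) (hfl : formCoeff m l f ≠ 0) : mono m l ∈ S := by
  obtain ⟨t, ht, hinj⟩ := exists_injOn_pow_mul_star_pow m
  rw [← S.smul_mem_iff hfl]
  refine mem_of_sum_mem_of_eigenvectors (v := fun l => formCoeff m l f • mono m l)
    (hS (ofPair t 0 (by simpa using ht))) hinj (fun k hk => ?_)
    (by rwa [sum_formCoeff_smul_mono]) (Finset.mem_range_succ_iff.mpr hl)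
  rw [map_smul, rho_ofPair_diag_mono (Finset.mem_range_succ_iff.mp hk), smul_comm]

theorem formCoeff_self (f : P m) : formCoeff m m f = MvPolynomial.eval ![1, 0] (incl m f) := by
  rw [eval_incl, Finset.sum_eq_single_of_mem m (Finset.self_mem_range_succ m)]
  · simp
  · intro l hl hlm
    have hpos : m - l ≠ 0 := by grind
    simp [hpos]

theorem mono_self (m : ℕ) : mono m m = linPow m ![1, 0] := by
  apply incl_injective
  simp [incl_mono le_rfl, incl_linPow]

/-- The rotation by the angle with cosine `3/5`: a group element all of whose entries are
non-zero, so that it moves every monomial to a form with non-zero leading coefficient. -/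
def rotation : SU2 := ofPair (3 / 5) (4 / 5) (by simp; norm_num)

theorem eq_top_of_invariant (hS : ∀ g, ∀ f ∈ S, rho m g f ∈ S) (h : S ≠ ⊥) : S = ⊤ := by
  obtain ⟨f, hf, hf0⟩ := S.ne_bot_iff.mp h
  obtain ⟨l, hl, hfl⟩ : ∃ l ≤ m, formCoeff m l f ≠ 0 := by
    by_contra! hcon
    exact hf0 (form_ext fun l hl => by rw [hcon l hl, map_zero])
  have highest_mem : mono m m ∈ S := by
    refine mono_mem_of_formCoeff_ne_zero hS
      (hS rotation _ (mono_mem_of_formCoeff_ne_zero hS hf hl hfl)) le_rfl ?_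
    rw [formCoeff_self, incl_rho, eval_subst, incl_mono hl]
    simp [rotation, ofPair]
  have mono_mem : ∀ k ≤ m, mono m k ∈ S := by
    intro k hk
    refine mono_mem_of_formCoeff_ne_zero hS (hS rotation _ highest_mem) hk ?_
    rw [mono_self, rho_linPow, formCoeff_linPow hk]
    simp [rotation, ofPair, Nat.choose_eq_zero_iff, hk]
  refine eq_top_iff.mpr fun p _ => ?_
  rw [← sum_formCoeff_smul_mono p]
  exact S.sum_mem fun k hk => S.smul_mem _ (mono_mem k (Finset.mem_range_succ_iff.mp hk))

theorem isIrreducible_rho (m : ℕ) : (rho m).IsIrreducible := by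
  refine isIrreducible_iff_invariant.mpr ⟨?_, fun S hS => ?_⟩
  · exact Module.nontrivial_of_finrank_pos (R := ℂ) (by simp [finrank_P])
  · exact or_iff_not_imp_left.mpr (eq_top_of_invariant hS)

end Irreducibility

section AlphaEquivariance

open MvPolynomial

/-- The substitution `f(x, y) ↦ f(x g, y g)`, the polynomial model of the tensor product action. -/
def subst₂ (g : Matrix (Fin 2) (Fin 2) ℂ) :
    MvPolynomial (Fin 2 ⊕ Fin 2) ℂ →ₐ[ℂ] MvPolynomial (Fin 2 ⊕ Fin 2) ℂ :=
  aeval (Sum.elim (fun j => ∑ i, C (g i j) * X (Sum.inl i)) fun j => ∑ i, C (g i j) * X (Sum.inr i))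

/-- `Δ_{yx}` as a derivation, which gives access to the Leibniz rule. -/
def polarization :
    Derivation ℂ (MvPolynomial (Fin 2 ⊕ Fin 2) ℂ) (MvPolynomial (Fin 2 ⊕ Fin 2) ℂ) :=
  mkDerivation ℂ (Sum.elim (fun i => X (Sum.inr i)) 0)

theorem Δyx_eq_polarization : Δyx = (polarization : Module.End ℂ _) := by
  have hsum : polarization = ∑ i : Fin 2, (X (Sum.inr i) : MvPolynomial (Fin 2 ⊕ Fin 2) ℂ) •
      pderiv (Sum.inl i) := by
    refine derivation_ext fun i => ?_
    rcases i with i | i <;> fin_cases i <;>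
      simp [polarization, mkDerivation_X, pderiv_X, Derivation.add_apply]
  refine LinearMap.ext fun p => ?_
  simp [hsum, Δyx]

theorem subst₂_rename_inl (g : Matrix (Fin 2) (Fin 2) ℂ) (p : MvPolynomial (Fin 2) ℂ) :
    subst₂ g (rename Sum.inl p) = rename Sum.inl (subst g p) := by
  have hcomp : (subst₂ g).comp (rename Sum.inl) = (rename Sum.inl).comp (subst g) := by
    ext1 j
    simp [subst₂, subst]
  exact DFunLike.congr_fun hcomp p

theorem commute_subst₂_Γxy {g : Matrix (Fin 2) (Fin 2) ℂ} (hg : g.det = 1) :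
    Commute (subst₂ g).toLinearMap Γxy := by
  have det_eq : (C (g 0 0) * C (g 1 1) - C (g 0 1) * C (g 1 0) :
      MvPolynomial (Fin 2 ⊕ Fin 2) ℂ) = 1 := by
    rw [← C_mul, ← C_mul, ← C_sub, ← Matrix.det_fin_two, hg, C_1]
  refine LinearMap.ext fun p => ?_
  simp only [Γxy, Module.End.mul_apply, LinearMap.mulLeft_apply, AlgHom.toLinearMap_apply, map_mul]
  congr 1
  simp only [subst₂, map_sub, map_mul, aeval_X, Sum.elim_inl, Sum.elim_inr, Fin.sum_univ_two]
  linear_combination (X (Sum.inl 0) * X (Sum.inr 1) - X (Sum.inr 0) * X (Sum.inl 1)) * det_eq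

theorem commute_subst₂_Δyx (g : Matrix (Fin 2) (Fin 2) ℂ) :
    Commute (subst₂ g).toLinearMap Δyx := by
  rw [Δyx_eq_polarization]
  refine LinearMap.ext fun p => ?_
  simp only [Module.End.mul_apply, AlgHom.toLinearMap_apply, Derivation.coeFn_coe]
  induction p using MvPolynomial.induction_on with
  | C a => simp [subst₂]
  | add p q hp hq => simp only [map_add, hp, hq]
  | mul_X p i hp =>
    have hX : subst₂ g (polarization (X i)) = polarization (subst₂ g (X i)) := by
      rcases i with i | i <;> simp [polarization, mkDerivation_X, subst₂]
    simp only [map_mul, Derivation.leibniz, smul_eq_mul, map_add, hp, hX]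

theorem incl_homComp_of_ne {k m : ℕ} (hkm : k ≠ m) {p : MvPolynomial (Fin 2) ℂ}
    (hp : p.IsHomogeneous k) : incl m (homComp m p) = 0 :=
  (homogeneousComponent_of_mem hp).trans (if_neg hkm.symm)

theorem homComp_subst (m : ℕ) (g : SU2) (p : MvPolynomial (Fin 2) ℂ) :
    homComp m (subst g.1 p) = rho m g (homComp m p) := by
  have of_isHomogeneous : ∀ k (q : MvPolynomial (Fin 2) ℂ), q.IsHomogeneous k →
      homComp m (subst g.1 q) = rho m g (homComp m q) := by
    intro k q hq
    have hgq := subst_isHomogeneous g.1 hq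
    apply incl_injective
    rw [incl_rho]
    obtain rfl | hkm := eq_or_ne k m
    · rw [incl_homComp hq, incl_homComp hgq]
    · rw [incl_homComp_of_ne hkm hq, incl_homComp_of_ne hkm hgq, map_zero]
  rw [← sum_homogeneousComponent p]
  simp only [map_sum]
  exact Finset.sum_congr rfl fun k _ =>
    of_isHomogeneous k _ (homogeneousComponent_isHomogeneous k p)

theorem subst₂_tensorEquivSum (g : Matrix (Fin 2) (Fin 2) ℂ) (p q : MvPolynomial (Fin 2) ℂ) :
    subst₂ g (tensorEquivSum ℂ (Fin 2) (Fin 2) ℂ (p ⊗ₜ q)) =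
      tensorEquivSum ℂ (Fin 2) (Fin 2) ℂ (subst g p ⊗ₜ subst g q) := by
  have hcomp : (subst₂ g).comp (tensorEquivSum ℂ (Fin 2) (Fin 2) ℂ).toAlgHom =
      (tensorEquivSum ℂ (Fin 2) (Fin 2) ℂ).toAlgHom.comp
        (Algebra.TensorProduct.map (subst g) (subst g)) := by
    ext j
    · fin_cases j <;>
        simp [subst₂, subst, TensorProduct.add_tmul, ← smul_eq_C_mul, ← TensorProduct.smul_tmul']
    · fin_cases j <;>
        simp [subst₂, subst, TensorProduct.tmul_add, ← smul_eq_C_mul]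
  exact DFunLike.congr_fun hcomp (p ⊗ₜ q)

theorem toTensor_subst₂ (m n : ℕ) (g : SU2) (p : MvPolynomial (Fin 2 ⊕ Fin 2) ℂ) :
    toTensor m n (subst₂ g.1 p) = (rho m).tprod (rho n) g (toTensor m n p) := by
  obtain ⟨t, rfl⟩ := (tensorEquivSum ℂ (Fin 2) (Fin 2) ℂ).surjective p
  induction t with
  | zero => simp
  | add s t hs ht => simp only [map_add, hs, ht]
  | tmul p q =>
    rw [subst₂_tensorEquivSum]
    simp [toTensor, homComp_subst]

theorem alpha_apply (r m n h : ℕ) (f : P r) : alpha r m n h f =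
    (Real.sqrt (cgCoeff m n h) : ℂ) •
      toTensor m n ((Γxy ^ h) ((Δyx ^ (n - h)) (rename Sum.inl (incl r f)))) := rfl

theorem isIntertwiningMap_alpha (r m n h : ℕ) :
    Representation.IsIntertwiningMap (rho r) ((rho m).tprod (rho n)) (alpha r m n h) := by
  refine ⟨fun g f => ?_⟩
  have hΔ := DFunLike.congr_fun ((commute_subst₂_Δyx g.1).pow_right (n - h)).eq
    (rename Sum.inl (incl r f))
  have hΓ := DFunLike.congr_fun ((commute_subst₂_Γxy g.2.2).pow_right h).eq
    ((Δyx ^ (n - h)) (rename Sum.inl (incl r f)))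
  simp only [Module.End.mul_apply, AlgHom.toLinearMap_apply] at hΔ hΓ
  rw [alpha_apply, alpha_apply, incl_rho, ← subst₂_rename_inl, ← hΔ, ← hΓ, toTensor_subst₂,
    map_smul]

end AlphaEquivariance

section Normalization

open Finset.HasAntidiagonal (antidiagonal mem_antidiagonal)

theorem cgCoeff_mul_factorials (p q h : ℕ) :
    cgCoeff (p + h) (q + h) h * (h.factorial * q.factorial * (p + q + h + 1).factorial) =
      (p + q + 1) * p.factorial := by
  induction hn : q + h generalizing p q h with
  | zero =>
    obtain ⟨rfl, rfl⟩ := Nat.add_eq_zero_iff.mp hn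
    simp [cgCoeff, Nat.factorial_succ]
  | succ n ih =>
    have first_summand : (if 0 < h then cgCoeff (p + h - 1) n (h - 1) else 0) *
        (h.factorial * q.factorial * (p + q + h + 1).factorial) =
          h * (p + q + h + 1) * ((p + q + 1) * p.factorial) := by
      rcases h with _ | h
      · simp
      · have hih := ih p q h (by omega)
        rw [if_pos h.succ_pos, Nat.add_succ_sub_one, Nat.succ_sub_one, ← add_assoc,
          Nat.factorial_succ h, Nat.factorial_succ (p + q + h + 1)]
        push_cast
        linear_combination (h + 1 : ℝ) * (p + q + h + 1 + 1) * hih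
    have second_summand : (if h < n + 1 then cgCoeff (p + h + 1) n h else 0) *
        (h.factorial * q.factorial * (p + q + h + 1).factorial) =
          (p + 1) * q * ((p + q + 1) * p.factorial) := by
      rcases q with _ | q
      · simp [show ¬ h < n + 1 by omega]
      · have hih := ih (p + 1) q h (by omega)
        rw [if_pos (by omega), show p + (q + 1) + h + 1 = p + 1 + q + h + 1 by ring,
          show p + h + 1 = p + 1 + h by ring, Nat.factorial_succ q]
        rw [Nat.factorial_succ p] at hih
        push_cast at hih ⊢
        linear_combination (q + 1 : ℝ) * hih
    have hn' : (n : ℝ) + 1 = q + h := by exact_mod_cast hn.symm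
    have hpos : (q : ℝ) + h ≠ 0 := by rw [← hn']; positivity
    rw [cgCoeff, hn', mul_assoc, add_mul (ite _ _ _), first_summand, second_summand]
    push_cast
    field_simp
    ring

theorem cgCoeff_nonneg (p q h : ℕ) : 0 ≤ cgCoeff (p + h) (q + h) h :=
  nonneg_of_mul_nonneg_left (by rw [cgCoeff_mul_factorials]; positivity)
    (show 0 < (h.factorial * q.factorial * (p + q + h + 1).factorial : ℝ) by positivity)

theorem sum_antidiagonal_choose_mul_choose (p q h : ℕ) :
    ∑ x ∈ antidiagonal h, (p + x.1).choose p * (q + x.2).choose q =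
      (p + q + 1 + h).choose h := by
  have product := congrArg (fun u => PowerSeries.coeff h u.val)
    (PowerSeries.invOneSubPow_add (S := ℤ) (p + 1) (q + 1))
  rw [show p + 1 + (q + 1) = p + q + 1 + 1 by ring] at product
  simp only [Units.val_mul, PowerSeries.invOneSubPow_val_succ_eq_mk_add_choose,
    PowerSeries.coeff_mul, PowerSeries.coeff_mk] at product
  rw [← Nat.choose_symm_add]
  exact_mod_cast product.symm

theorem sum_antidiagonal_choose_sq_mul_factorials (p q h : ℕ) :
    (∑ x ∈ antidiagonal h, h.choose x.1 ^ 2 *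
      ((p + x.1).factorial * x.2.factorial * ((q + x.2).factorial * x.1.factorial))) *
        (p + q + 1).factorial =
      h.factorial * p.factorial * q.factorial * (p + q + h + 1).factorial := by
  have summand : ∀ x ∈ antidiagonal h, h.choose x.1 ^ 2 *
      ((p + x.1).factorial * x.2.factorial * ((q + x.2).factorial * x.1.factorial)) =
        h.factorial ^ 2 * p.factorial * q.factorial *
          ((p + x.1).choose p * (q + x.2).choose q) := by
    rintro ⟨j, k⟩ hjk
    obtain rfl := mem_antidiagonal.mp hjk
    rw [@Nat.choose_symm_add j k, @Nat.choose_symm_add p j, @Nat.choose_symm_add q k,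
      ← Nat.add_choose_mul_factorial_mul_factorial j k,
      ← Nat.add_choose_mul_factorial_mul_factorial p j,
      ← Nat.add_choose_mul_factorial_mul_factorial q k]
    ring
  rw [Finset.sum_congr rfl summand, ← Finset.mul_sum, sum_antidiagonal_choose_mul_choose,
    show p + q + h + 1 = p + q + 1 + h by ring,
    ← Nat.add_choose_mul_factorial_mul_factorial (p + q + 1) h]
  ring

theorem cgCoeff_mul_descFactorial_sq_mul_sum (p q h : ℕ) :
    cgCoeff (p + h) (q + h) h * ((p + q).descFactorial q ^ 2 *
      (∑ x ∈ antidiagonal h, h.choose x.1 ^ 2 *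
        ((p + x.1).factorial * x.2.factorial * ((q + x.2).factorial * x.1.factorial)) : ℕ)) =
      (p + q).factorial := by
  have coeff_eq := cgCoeff_mul_factorials p q h
  have sum_eq := congrArg (Nat.cast (R := ℝ)) (sum_antidiagonal_choose_sq_mul_factorials p q h)
  have desc_eq := congrArg (Nat.cast (R := ℝ)) (Nat.factorial_mul_descFactorial (q.le_add_left p))
  have succ_eq := congrArg (Nat.cast (R := ℝ)) (Nat.factorial_succ (p + q))
  generalize (∑ x ∈ antidiagonal h, _ : ℕ) = S at sum_eq ⊢
  push_cast [Nat.add_sub_cancel] at sum_eq desc_eq succ_eq ⊢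
  refine mul_right_cancel₀ (b := ((p + q + 1).factorial : ℝ)) (by positivity) ?_
  generalize ((p + q).descFactorial q : ℝ) = D at *
  linear_combination cgCoeff (p + h) (q + h) h * D ^ 2 * sum_eq +
    D ^ 2 * p.factorial * coeff_eq +
    (p + q + 1) * (p.factorial * D + (p + q).factorial) * desc_eq - (p + q).factorial * succ_eq

end Normalization

section HighestWeight

open MvPolynomial
open Finset.HasAntidiagonal (antidiagonal mem_antidiagonal)

theorem Δyx_pow_X_pow (r k : ℕ) :
    (Δyx ^ k) (X (Sum.inl 0) ^ r) =
      r.descFactorial k • (X (Sum.inl 0) ^ (r - k) * X (Sum.inr 0) ^ k) := by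
  have hinl : polarization (X (Sum.inl 0)) = X (Sum.inr 0) := by
    simp [polarization, mkDerivation_X]
  have hinr : polarization (X (Sum.inr 0)) = 0 := by
    simp [polarization, mkDerivation_X]
  induction k with
  | zero => simp
  | succ k ih =>
    rw [pow_succ', Module.End.mul_apply, ih, map_nsmul, Δyx_eq_polarization,
      Derivation.coeFn_coe, Derivation.leibniz, Derivation.leibniz_pow, Derivation.leibniz_pow,
      hinl, hinr, Nat.descFactorial_succ, Nat.sub_sub]
    simp only [smul_eq_mul, nsmul_eq_mul, mul_zero, zero_add]
    push_cast
    ring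

theorem toTensor_monomial {m n l k : ℕ} (hl : l ≤ m) (hk : k ≤ n) :
    toTensor m n (X (Sum.inl 0) ^ l * X (Sum.inl 1) ^ (m - l) *
      (X (Sum.inr 0) ^ k * X (Sum.inr 1) ^ (n - k))) = mono m l ⊗ₜ mono n k := by
  rw [← toTensor_mul, incl_mono hl, incl_mono hk]
  simp only [map_mul, map_pow, rename_X]

/-- The highest weight vector of the copy of `P (p + q)` in `P (p + h) ⊗ P (q + h)`, that is,
`x₁ᵖ y₁^q (x₁ y₂ - y₁ x₂)ʰ` expanded in monomials. -/
def highestWeightVector (p q h : ℕ) : P (p + h) ⊗[ℂ] P (q + h) :=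
  ∑ x ∈ antidiagonal h, ((-1) ^ x.2 * h.choose x.1 : ℂ) •
    (mono (p + h) (p + x.1) ⊗ₜ[ℂ] mono (q + h) (q + x.2))

theorem toTensor_mul_Γxy_pow (p q h : ℕ) :
    toTensor (p + h) (q + h) ((Γxy ^ h) (X (Sum.inl 0) ^ p * X (Sum.inr 0) ^ q)) =
      highestWeightVector p q h := by
  rw [Γxy, LinearMap.pow_mulLeft, LinearMap.mulLeft_apply, sub_eq_add_neg,
    (Commute.all _ _).add_pow', Finset.sum_mul, map_sum, highestWeightVector]
  refine Finset.sum_congr rfl fun x hx => ?_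
  obtain rfl := mem_antidiagonal.mp hx
  rw [← toTensor_monomial (by omega) (by omega), ← map_smul,
    show p + (x.1 + x.2) - (p + x.1) = x.2 by omega,
    show q + (x.1 + x.2) - (q + x.2) = x.1 by omega, smul_eq_C_mul, nsmul_eq_mul]
  congr 1
  simp only [C_mul, C_pow, C_neg, C_1, map_natCast]
  rw [neg_pow]
  ring

theorem alpha_mono_self (p q h : ℕ) :
    alpha (p + q) (p + h) (q + h) h (mono (p + q) (p + q)) =
      (Real.sqrt (cgCoeff (p + h) (q + h) h) * (p + q).descFactorial q : ℂ) •
        highestWeightVector p q h := by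
  rw [alpha_apply, incl_mono le_rfl, Nat.sub_self, pow_zero, mul_one, map_pow, rename_X,
    Nat.add_sub_cancel, Δyx_pow_X_pow, Nat.add_sub_cancel, map_nsmul, map_nsmul,
    toTensor_mul_Γxy_pow, ← Nat.cast_smul_eq_nsmul ℂ, smul_smul]

-- `inner_smul_left` and `inner_smul_right` do not rewrite here: the scalar action on `E ⊗ F`
-- found by elaboration agrees with that of the inner product space only after unfolding.
theorem inner_smul_smul_tensorProduct {E F : Type*} [NormedAddCommGroup E] [InnerProductSpace ℂ E]
    [NormedAddCommGroup F] [InnerProductSpace ℂ F] (c d : ℂ) (s t : E ⊗[ℂ] F) :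
    inner ℂ (c • s) (d • t) = star c * d * inner ℂ s t :=
  (inner_smul_left s (d • t) c).trans <|
    (congrArg _ (inner_smul_right s t d)).trans (mul_assoc _ _ _).symm

theorem inner_highestWeightVector_self (p q h : ℕ) :
    inner ℂ (highestWeightVector p q h) (highestWeightVector p q h) =
      ((∑ x ∈ antidiagonal h, h.choose x.1 ^ 2 *
        ((p + x.1).factorial * x.2.factorial * ((q + x.2).factorial * x.1.factorial)) : ℕ) :
          ℂ) := by
  rw [highestWeightVector, sum_inner, Nat.cast_sum]
  refine Finset.sum_congr rfl fun x hx => ?_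
  obtain rfl := mem_antidiagonal.mp hx
  rw [inner_sum, Finset.sum_eq_single_of_mem x hx]
  · rw [inner_smul_smul_tensorProduct, TensorProduct.inner_tmul,
      inner_mono (by omega) (by omega), inner_mono (by omega) (by omega), if_pos rfl, if_pos rfl,
      show p + (x.1 + x.2) - (p + x.1) = x.2 by omega,
      show q + (x.1 + x.2) - (q + x.2) = x.1 by omega]
    have hsign : ((-1 : ℂ) ^ x.2) * (-1) ^ x.2 = 1 := by rw [← mul_pow]; simp
    simp only [star_mul', star_pow, star_neg, star_one, star_natCast]
    push_cast
    linear_combination (((x.1 + x.2).choose x.1 : ℂ) ^ 2 *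
      ((p + x.1).factorial * x.2.factorial * ((q + x.2).factorial * x.1.factorial))) * hsign
  · intro y hy hyx
    have hsum := mem_antidiagonal.mp hy
    have hne : p + x.1 ≠ p + y.1 := fun heq => hyx (Prod.ext (by omega) (by omega))
    rw [inner_smul_smul_tensorProduct, TensorProduct.inner_tmul,
      inner_mono (by omega) (by omega), if_neg hne]
    simp

theorem inner_alpha_mono_self (p q h : ℕ) :
    inner ℂ (alpha (p + q) (p + h) (q + h) h (mono (p + q) (p + q)))
      (alpha (p + q) (p + h) (q + h) h (mono (p + q) (p + q))) = ((p + q).factorial : ℂ) := by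
  rw [alpha_mono_self, inner_smul_smul_tensorProduct, inner_highestWeightVector_self,
    ← Complex.ofReal_natCast (p + q).factorial, ← cgCoeff_mul_descFactorial_sq_mul_sum p q h]
  have sqrt_mul_sqrt : (Real.sqrt (cgCoeff (p + h) (q + h) h) : ℂ) *
      Real.sqrt (cgCoeff (p + h) (q + h) h) = cgCoeff (p + h) (q + h) h := by
    rw [← Complex.ofReal_mul, Real.mul_self_sqrt (cgCoeff_nonneg p q h)]
  rw [star_mul', star_natCast, Complex.star_def, Complex.conj_ofReal]
  generalize (∑ x ∈ antidiagonal h, _ : ℕ) = S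
  push_cast
  rw [← sqrt_mul_sqrt]
  ring

theorem isIntertwiningMap_adjoint_alpha (r m n h : ℕ) :
    Representation.IsIntertwiningMap ((rho m).tprod (rho n)) (rho r) (alpha r m n h).adjoint :=
  isIntertwiningMap_adjoint (isUnitary_rho r) ((isUnitary_rho m).tprod (isUnitary_rho n))
    (isIntertwiningMap_alpha r m n h)

theorem adjoint_alpha_comp_alpha {r m n h : ℕ} (hr : r + 2 * h = m + n) (hh : h ≤ min m n) :
    (alpha r m n h).adjoint ∘ₗ alpha r m n h = LinearMap.id := by
  obtain ⟨p, rfl⟩ := Nat.exists_eq_add_of_le' (hh.trans (min_le_left m n))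
  obtain ⟨q, rfl⟩ := Nat.exists_eq_add_of_le' (hh.trans (min_le_right _ n))
  obtain rfl : r = p + q := by omega
  have := isIrreducible_rho (p + q)
  obtain ⟨c, hc⟩ := intertwining_eq_smul_id (π := rho (p + q)) <| isIntertwiningMap_comp
    (isIntertwiningMap_adjoint_alpha (p + q) (p + h) (q + h) h)
    (isIntertwiningMap_alpha (p + q) (p + h) (q + h) h)
  have hnorm := inner_alpha_mono_self p q h
  rw [← LinearMap.adjoint_inner_right, ← LinearMap.comp_apply, hc, LinearMap.smul_apply,
    LinearMap.id_apply, inner_smul_right, inner_mono le_rfl le_rfl, if_pos rfl, Nat.sub_self,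
    Nat.factorial_zero, mul_one] at hnorm
  rw [hc, mul_left_eq_self₀.mp hnorm |>.resolve_right (by positivity), one_smul]

end HighestWeight

section ClebschGordan

theorem sum_range_add_add_two_mul (a b k : ℕ) :
    ∑ i ∈ Finset.range k, (a + b + 2 * i + 1) + a * b = (a + k) * (b + k) := by
  induction k with
  | zero => simp
  | succ k ih =>
    rw [Finset.sum_range_succ, add_right_comm, ih]
    ring

theorem sum_finrank_clebschGordan (r m : ℕ) :
    ∑ i : Fin (min r m + 1), ((r - i) + (m - i) + 1) = (r + 1) * (m + 1) := by
  rw [Fin.sum_univ_eq_sum_range fun i => r - i + (m - i) + 1, ← Finset.sum_range_reflect]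
  have hzero : (r - min r m) * (m - min r m) = 0 := by
    rw [Nat.mul_eq_zero]
    omega
  have hsum := sum_range_add_add_two_mul (r - min r m) (m - min r m) (min r m + 1)
  rw [hzero, add_zero, show r - min r m + (min r m + 1) = r + 1 by omega,
    show m - min r m + (min r m + 1) = m + 1 by omega] at hsum
  rw [← hsum]
  refine Finset.sum_congr rfl fun i hi => ?_
  have := Finset.mem_range.mp hi
  omega

theorem EC_eq_range (r m : ℕ) : EC r m = Set.range fun i : Fin (min r m + 1) =>
    stinespring (alpha r m ((r - i) + (m - i)) (m - i)) := by
  refine Set.Subset.antisymm ?_ ?_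
  · rintro _ ⟨n, h, hr, hh, rfl⟩
    obtain ⟨i, rfl⟩ : ∃ i : Fin (min r m + 1), h = m - i :=
      ⟨⟨m - h, by omega⟩, (Nat.sub_sub_self (hh.trans (min_le_left m n))).symm⟩
    obtain rfl : n = (r - i) + (m - i) := by omega
    exact ⟨i, rfl⟩
  · rintro _ ⟨i, rfl⟩
    exact ⟨(r - i) + (m - i), m - i, by omega, by omega, rfl⟩

theorem isEmpty_equiv_rho {m n : ℕ} (hmn : m ≠ n) : IsEmpty ((rho m).Equiv (rho n)) :=
  ⟨fun e => hmn <| by simpa [finrank_P] using e.toLinearEquiv.finrank_eq⟩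

theorem isClebschGordanSystem_alpha (r m : ℕ) :
    IsClebschGordanSystem (rho r) (rho m)
      (fun i : Fin (min r m + 1) => rho ((r - i) + (m - i)))
      (fun i => alpha r m ((r - i) + (m - i)) (m - i)) where
  irreducible i := isIrreducible_rho _
  inequivalent i j hij := isEmpty_equiv_rho fun h => hij (Fin.ext (by omega))
  intertwining i := isIntertwiningMap_alpha _ _ _ _
  intertwining_adjoint i := isIntertwiningMap_adjoint_alpha _ _ _ _
  isometry i := adjoint_alpha_comp_alpha (by omega) (by omega)
  sum_finrank := by simpa only [finrank_P] using sum_finrank_clebschGordan r m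

end ClebschGordan

end SU2Channel

end

theorem corollary3p17 (r m : ℕ) :
    {Φ : Module.End ℂ (SU2Channel.P r) →ₗ[ℂ] Module.End ℂ (SU2Channel.P m) |
        SU2Channel.IsIrreduciblyCovariantChannel (SU2Channel.rho r) (SU2Channel.rho m) Φ} =
      convexHull ℝ (SU2Channel.EC r m) ∧
    (Submodule.span ℂ (SU2Channel.EC r m) :
        Set (Module.End ℂ (SU2Channel.P r) →ₗ[ℂ] Module.End ℂ (SU2Channel.P m))) =
      {Φ | SU2Channel.IsEquivariant (SU2Channel.rho r) (SU2Channel.rho m) Φ} := by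
  let α := fun i : Fin (min r m + 1) =>
    SU2Channel.alpha r m ((r - i) + (m - i)) (m - i)
  have hα : SU2Channel.IsClebschGordanSystem _ _ _ α := SU2Channel.isClebschGordanSystem_alpha r m
  have hr := SU2Channel.isIrreducible_rho r
  have hm := SU2Channel.isIrreducible_rho m
  obtain ⟨_, -⟩ := SU2Channel.isIrreducible_iff_invariant.mp hr
  rw [SU2Channel.EC_eq_range]
  exact ⟨(hα.convexHull_stinespring hr hm).symm, congrArg SetLike.coe hα.span_stinespring⟩
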